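/- **Pollaczek–Khintchine formula.** Consider an M/G/1 queue: customers $0,1,2,\dots$ arrive according to a Poisson process of rate $\lambda>0$ (independent, exponentially distributed inter-arrival times $X_0,X_1,\dots$) at a single-server queue with unlimited waiting room and first-in-first-out service, which is empty at time $0$. The service times $S_0,S_1,\dots$ are nonnegative, independent and identically distributed with mean $1/\mu$ ($\mu>0$) and finite standard deviation $\sigma_s$, and are independent of the arrival process. Put $\rho=\lambda/\mu$ and assume that the queue is stable, $\rho<1$. Let $Q(t)$ be the number of customers in the system (waiting or in service) at time $t$, let $q_i$ be the number of customers in the system immediately after the departure of customer $i$, let $a_i$ be the number of arrivals during the service time of customer $i$, and let $I(0)=0$, $I(k)=1$ for $k\ge 1$. Then: 1. The long-run mean number in system satisfies, almost surely, $$E[Q]:=\lim_{T\to\infty}\frac1T\int_0^T Q(t)\,dt=\rho+\frac{\rho^2+\lambda^2\sigma_s^2}{2(1-\rho)}.$$ 2. Almost surely, Kendall's recursion $q_{i+1}=q_i+a_{i+1}-I(q_i)$ holds for all $i\ge 0$. 3. The numbers left behind at departures have a steady state with the same mean: there is a probability distribution $(\pi_k)_{k\ge0}$ such that $\lim_{i\to\infty}P(q_i=k)=\pi_k$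 for every $k$; for every customer $i$ it is the unique probability distribution on $\{0,1,2,\dots\}$ satisfying the steady-state equations $\pi_k=\sum_{j\ge0}\pi_j\,P\big(j+a_i-I(j)=k\big)$, $k\ge 0$; and $$\sum_{k\ge0}k\,\pi_k=\rho+\frac{\rho^2+\lambda^2\sigma_s^2}{2(1-\rho)}.$$ -/

import Mathlib

open MeasureTheory ProbabilityTheory Filter Topology

namespace MG1

/-! ### Sample-path description of a first-in-first-out single-server queue

The queue has an unlimited waiting room and is empty at time `0`.  Customers are numbered
`0, 1, 2, …` in the order of arrival; `x n` is the time between the arrivals of customers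
`n - 1` and `n` (for `n = 0`, the time from `0` to the first arrival), and `s n` is the service
time of customer `n`. -/

/-- The arrival time of customer `n`. -/
def arrivalTime (x : ℕ → ℝ) (n : ℕ) : ℝ := ∑ k ∈ Finset.range (n + 1), x k

/-- The time at which the service of customer `n` starts: at the arrival of the customer or at the
departure of the preceding customer, whichever is later. -/
noncomputable def serviceStart (x s : ℕ → ℝ) : ℕ → ℝ
  | 0 => arrivalTime x 0
  | n + 1 => max (arrivalTime x (n + 1)) (serviceStart x s n + s n)

/-- The departure time of customer `n`. -/
noncomputable def departureTime (x s : ℕ → ℝ) (n : ℕ) : ℝ := serviceStart x s n + s n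

/-- The number of customers in the system (waiting or in service) at time `t`. -/
noncomputable def numberInSystem (x s : ℕ → ℝ) (t : ℝ) : ℕ :=
  {n : ℕ | arrivalTime x n ≤ t ∧ t < departureTime x s n}.ncard

/-- The number of customers in the system immediately after the departure of customer `n`, that is,
the number of later customers who have arrived by then. -/
noncomputable def numberLeftBehind (x s : ℕ → ℝ) (n : ℕ) : ℕ :=
  {m : ℕ | n < m ∧ arrivalTime x m ≤ departureTime x s n}.ncard

/-- The number of arrivals during the service time of customer `n`. -/
noncomputable def arrivalsDuringService (x s : ℕ → ℝ) (n : ℕ) : ℕ :=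
  {m : ℕ | serviceStart x s n < arrivalTime x m ∧ arrivalTime x m ≤ departureTime x s n}.ncard

/-- The function `I` with `I 0 = 0` and `I k = 1` for `k > 0`. -/
def busyIndicator (k : ℕ) : ℕ := if 0 < k then 1 else 0

/-- The random inter-arrival times `X n` and service times `S n` are those of an M/G/1 queue: the
arrivals form a Poisson process of rate `lam` (independent exponential inter-arrival times), the
service times are nonnegative, independent and identically distributed with mean `1 / mu` and
(finite) standard deviation `sigma`, and they are independent of the arrival process. -/
structure IsMG1 {Ω : Type*} [MeasurableSpace Ω] (P : Measure Ω) (lam mu sigma : ℝ)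
    (X S : ℕ → Ω → ℝ) : Prop where
  measurable_interarrival : ∀ n, Measurable (X n)
  measurable_service : ∀ n, Measurable (S n)
  law_interarrival : ∀ n, P.map (X n) = expMeasure lam
  indep_interarrival : iIndepFun X P
  service_nonneg : ∀ n, ∀ᵐ ω ∂P, 0 ≤ S n ω
  identDistrib_service : ∀ n, IdentDistrib (S n) (S 0) P P
  indep_service : iIndepFun S P
  indep_interarrival_service : IndepFun (fun ω n => X n ω) (fun ω n => S n ω) P
  memLp_service : MemLp (S 0) 2 P
  mean_service : ∫ ω, S 0 ω ∂P = 1 / mu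
  variance_service : Var[S 0; P] = sigma ^ 2

/-- The number in system at time `t`, as a random variable. -/
noncomputable def Q {Ω : Type*} (X S : ℕ → Ω → ℝ) (t : ℝ) (ω : Ω) : ℕ :=
  numberInSystem (fun k => X k ω) (fun k => S k ω) t

/-- The number in system immediately after the departure of customer `n`, as a random variable. -/
noncomputable def q {Ω : Type*} (X S : ℕ → Ω → ℝ) (n : ℕ) (ω : Ω) : ℕ :=
  numberLeftBehind (fun k => X k ω) (fun k => S k ω) n

/-- The number of arrivals during the service of customer `n`, as a random variable. -/
noncomputable def a {Ω : Type*} (X S : ℕ → Ω → ℝ) (n : ℕ) (ω : Ω) : ℕ :=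
  arrivalsDuringService (fun k => X k ω) (fun k => S k ω) n

/-- A sequence of reals is a probability distribution on `ℕ`. -/
def IsDistribution (p : ℕ → ℝ) : Prop := (∀ k, 0 ≤ p k) ∧ HasSum p 1

/-- The steady-state equations `p j = ∑ i, p i * P i j` of the recursion `i ↦ i + α - I i`, in which
the increment `α` has the law of the given random variable and is independent of the state. -/
def IsSteadyState {Ω : Type*} [MeasurableSpace Ω] (P : Measure Ω) (α : Ω → ℕ) (p : ℕ → ℝ) : Prop :=
  ∀ j : ℕ, HasSum
    (fun i : ℕ => p i * P.real {ω | (i : ℤ) + (α ω : ℤ) - (busyIndicator i : ℤ) = (j : ℤ)}) (p j)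

end MG1

/-!
The waiting times `W n` of the customers obey Lindley's recursion
`W (n + 1) = max 0 (W n + S n - X (n + 1))` (`serviceStart_eq`), so the whole model is a functional
of a random walk with negative drift and of the arrivals after each customer.

Two of the claims are statements about sample paths. On every regular path (positive inter-arrival
times with divergent sum, nonnegative service times) Kendall's recursion follows by counting
arrivals (`RegularPath.kendall`), and the time average of the number in system is the arrival rate
times the average of the sojourn times `W n + S n` (`RegularPath.tendsto_average_numberInSystem`,
Little's law): the area under the number in system up to time `T` lies between the total sojourn
time of the customers who departed by `T` and that of the customers who arrived by `T`.

The averages of the waiting times converge almost surely to the mean of the stationary waiting time.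
On the space of two-sided independent sequences, `lindleyFrom n`, the recursion started from `0` at
time `-n`, has the law of `W n` and increases with `n` to `stationaryLindley`, which is finite
because the drift is negative. For each `m` the averages of `lindleyFrom m` along the shift converge
by the strong law of large numbers for functions of finitely many coordinates
(`tendsto_birkhoffSum_div_of_dependsOn`). The remainder `stationaryLindley - lindleyFrom m` has
small mean, and the maximal ergodic inequality (`measureReal_exists_birkhoffSum_gt`) bounds its averages.
As `lindleyFrom m ≤ W n ≤ stationaryLindley` along the shift for `m ≤ n`, this suffices; ergodicity
of the shift is not needed.

The arrivals after customer `n` form a Poisson process independent of the sojourn time of this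
customer. Hence the number left behind at its departure is mixed Poisson
(`IsMG1.measureReal_q_eq`), and its law converges to the Poisson distribution mixed over the
stationary sojourn time, `limitDist`. Similarly the number of arrivals during a service is mixed
Poisson over the service time (`IsMG1.measureReal_a_eq`). The loss of memory of the exponential
distribution, in the form `integral_poissonWeight_max`, turns Lindley's recursion for the waiting
times into the steady-state equations for `limitDist` (`IsMG1.limitDist_eq`). These can be solved
successively for `p 1, p 2, …` in terms of `p 0`, so they have only one probability solution
(`IsDistribution.eq_of_steadyState`).

Finally, Lindley's recursion gives an equation for the Laplace transform of the stationary waiting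
time (`IsMG1.laplace_stationaryLindley`). Its expansion at `0` shows that the stationary waiting
time is integrable and gives its mean `lam * E[S ^ 2] / (2 * (1 - rho))`
(`IsMG1.integrable_and_integral_stationaryLindley`). Both means in question are `lam` times the mean
stationary sojourn time `1 / mu + lam * E[S ^ 2] / (2 * (1 - rho))`.
-/

namespace MG1

/-! ### The waiting times and the counts along a sample path -/

/-- Lindley's recursion `W (n + 1) = max 0 (W n + u n)`, started at `W 0 = 0`. -/
noncomputable def lindley (u : ℕ → ℝ) : ℕ → ℝ
  | 0 => 0
  | n + 1 => max 0 (lindley u n + u n)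

/-- The time customer `n` waits before service. -/
noncomputable def waitingTime (x s : ℕ → ℝ) (n : ℕ) : ℝ := lindley (fun k => s k - x (k + 1)) n

/-- The time customer `n` spends in the system. -/
noncomputable def sojournTime (x s : ℕ → ℝ) (n : ℕ) : ℝ := waitingTime x s n + s n

/-- Exactly the first `k` of the arrivals with inter-arrival times `y` happen by time `t`. Unlike
the cardinality of the set of these arrivals, this is not affected by a junk value when infinitely
many customers arrive by time `t`. -/
def CountIs (y : ℕ → ℝ) (t : ℝ) (k : ℕ) : Prop := ∀ m, arrivalTime y m ≤ t ↔ m < k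

lemma lindley_nonneg (u : ℕ → ℝ) : ∀ n, 0 ≤ lindley u n
  | 0 => le_rfl
  | _ + 1 => le_max_left _ _

lemma waitingTime_nonneg (x s : ℕ → ℝ) (n : ℕ) : 0 ≤ waitingTime x s n := lindley_nonneg _ n

lemma waitingTime_succ (x s : ℕ → ℝ) (n : ℕ) :
    waitingTime x s (n + 1) = max 0 (sojournTime x s n - x (n + 1)) := by
  simp only [waitingTime, sojournTime, lindley]
  congr 1; ring

lemma arrivalTime_succ (x : ℕ → ℝ) (n : ℕ) :
    arrivalTime x (n + 1) = arrivalTime x n + x (n + 1) := by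
  simp [arrivalTime, Finset.sum_range_succ]

lemma arrivalTime_succ' (x : ℕ → ℝ) (n : ℕ) :
    arrivalTime x (n + 1) = x 0 + arrivalTime (fun k => x (k + 1)) n := by
  simp only [arrivalTime]
  rw [Finset.sum_range_succ', add_comm]

lemma arrivalTime_add (x : ℕ → ℝ) (n m : ℕ) :
    arrivalTime x (n + 1 + m) = arrivalTime x n + arrivalTime (fun k => x (n + 1 + k)) m := by
  simp only [arrivalTime]
  rw [add_assoc (n + 1) m 1, Finset.sum_range_add]

lemma serviceStart_eq (x s : ℕ → ℝ) (n : ℕ) :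
    serviceStart x s n = arrivalTime x n + waitingTime x s n := by
  induction n with
  | zero => simp [serviceStart, waitingTime, lindley]
  | succ n ih =>
    rw [serviceStart, ih, waitingTime_succ, arrivalTime_succ, ← max_add_add_left, sojournTime]
    congr 1 <;> ring

lemma departureTime_eq (x s : ℕ → ℝ) (n : ℕ) :
    departureTime x s n = arrivalTime x n + sojournTime x s n := by
  rw [departureTime, serviceStart_eq, sojournTime, add_assoc]

lemma sojournTime_nonneg {x s : ℕ → ℝ} (hs : ∀ k, 0 ≤ s k) (n : ℕ) : 0 ≤ sojournTime x s n :=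
  add_nonneg (waitingTime_nonneg x s n) (hs n)

lemma arrivalTime_strictMono {x : ℕ → ℝ} (hx : ∀ k, 0 < x k) : StrictMono (arrivalTime x) :=
  strictMono_nat_of_lt_succ fun n => by rw [arrivalTime_succ]; linarith [hx (n + 1)]

lemma arrivalTime_pos {x : ℕ → ℝ} (hx : ∀ k, 0 < x k) (n : ℕ) : 0 < arrivalTime x n :=
  Finset.sum_pos (fun k _ => hx k) (by simp)

lemma departureTime_mono {x s : ℕ → ℝ} (hs : ∀ k, 0 ≤ s k) : Monotone (departureTime x s) :=
  monotone_nat_of_le_succ fun n => by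
    rw [departureTime, departureTime, serviceStart]
    linarith [hs (n + 1), le_max_right (arrivalTime x (n + 1)) (serviceStart x s n + s n)]

lemma exists_count {b : ℕ → ℝ} (hb : Monotone b) (h : Tendsto b atTop atTop) (t : ℝ) :
    ∃ k, ∀ m, b m ≤ t ↔ m < k := by
  classical
  have hex : ∃ n, t < b n := (h.eventually_gt_atTop t).exists
  refine ⟨Nat.find hex, fun m => ⟨fun hm => ?_, fun hm => ?_⟩⟩
  · by_contra hlt
    exact absurd (Nat.find_spec hex) (not_lt.2 ((hb (not_lt.1 hlt)).trans hm))
  · exact not_lt.1 (Nat.find_min hex hm)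

lemma CountIs.unique {y : ℕ → ℝ} {t : ℝ} {k l : ℕ} (hk : CountIs y t k) (hl : CountIs y t l) :
    k = l := by
  by_contra h
  rcases Nat.lt_or_gt_of_ne h with h | h
  · exact lt_irrefl k ((hk k).1 ((hl k).2 h))
  · exact lt_irrefl l ((hl l).1 ((hk l).2 h))

lemma CountIs.mono {y : ℕ → ℝ} {t u : ℝ} {k l : ℕ} (hk : CountIs y t k) (hl : CountIs y u l)
    (htu : t ≤ u) : k ≤ l := by
  by_contra h
  push Not at h
  exact lt_irrefl l ((hl l).1 (((hk l).2 h).trans htu))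

lemma CountIs.succ_le {y : ℕ → ℝ} {t : ℝ} {n k : ℕ} (hk : CountIs y t k)
    (ht : arrivalTime y n ≤ t) : n + 1 ≤ k := (hk n).1 ht

lemma ncard_arrivals_Ioc {x : ℕ → ℝ} {t u : ℝ} {k l : ℕ} (hk : CountIs x t k)
    (hl : CountIs x u l) : {m : ℕ | t < arrivalTime x m ∧ arrivalTime x m ≤ u}.ncard = l - k := by
  have : {m : ℕ | t < arrivalTime x m ∧ arrivalTime x m ≤ u} = (Finset.Ico k l : Set ℕ) := by
    ext m
    simp only [Set.mem_ofPred_eq, Finset.coe_Ico, Set.mem_Ico, hl m]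
    rw [← not_le, hk m, not_lt]
  rw [this, Set.ncard_coe_finset, Nat.card_Ico]

/-- The sample paths on which the counts of customers behave: customers arrive one at a time, only
finitely many in bounded time, and the service times are nonnegative. -/
structure RegularPath (x s : ℕ → ℝ) : Prop where
  interarrival_pos : ∀ k, 0 < x k
  service_nonneg : ∀ k, 0 ≤ s k
  tendsto_arrivalTime : Tendsto (arrivalTime x) atTop atTop

namespace RegularPath

variable {x s : ℕ → ℝ} (h : RegularPath x s)
include h

lemma exists_countIs (t : ℝ) : ∃ k, CountIs x t k :=
  exists_count (arrivalTime_strictMono h.interarrival_pos).monotone h.tendsto_arrivalTime t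

lemma numberLeftBehind_eq {n k : ℕ} (hk : CountIs x (departureTime x s n) k) :
    numberLeftBehind x s n = k - (n + 1) := by
  rw [← ncard_arrivals_Ioc (k := n + 1) (t := arrivalTime x n) _ hk]
  · rw [numberLeftBehind]
    congr 1; ext m
    simp only [Set.mem_ofPred_eq, (arrivalTime_strictMono h.interarrival_pos).lt_iff_lt]
  · intro m
    rw [(arrivalTime_strictMono h.interarrival_pos).le_iff_le, Nat.lt_succ_iff]

lemma arrivalTime_le_departureTime (n : ℕ) : arrivalTime x n ≤ departureTime x s n := by
  rw [departureTime_eq]; linarith [sojournTime_nonneg (x := x) h.service_nonneg n]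

/-- Kendall's recursion. If customer `n` leaves somebody behind, the next service starts at the
departure of customer `n`; otherwise it starts with the next arrival, which does not count as an
arrival during that service. -/
lemma kendall (n : ℕ) :
    (numberLeftBehind x s (n + 1) : ℤ) = numberLeftBehind x s n
      + arrivalsDuringService x s (n + 1) - busyIndicator (numberLeftBehind x s n) := by
  obtain ⟨k, hk⟩ := h.exists_countIs (departureTime x s n)
  obtain ⟨l, hl⟩ := h.exists_countIs (departureTime x s (n + 1))
  have hk1 := hk.succ_le (h.arrivalTime_le_departureTime n)
  have hl1 := hl.succ_le (h.arrivalTime_le_departureTime (n + 1))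
  rw [h.numberLeftBehind_eq hk, h.numberLeftBehind_eq hl, arrivalsDuringService]
  have hkl := hk.mono hl (departureTime_mono h.service_nonneg n.le_succ)
  have hstart : serviceStart x s (n + 1) = max (arrivalTime x (n + 1)) (departureTime x s n) := rfl
  rcases le_or_gt (arrivalTime x (n + 1)) (departureTime x s n) with hle | hlt
  · rw [hstart, max_eq_right hle, ncard_arrivals_Ioc hk hl, busyIndicator, if_pos]
    · have := hk.succ_le hle
      omega
    · have := hk.succ_le hle
      omega
  · have hkn : k = n + 1 := by
      refine le_antisymm ?_ hk1
      by_contra hc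
      exact absurd ((hk (n + 1)).2 (by omega)) (not_le.2 hlt)
    have hcount : CountIs x (arrivalTime x (n + 1)) (n + 2) := fun m => by
      rw [(arrivalTime_strictMono h.interarrival_pos).le_iff_le]; omega
    rw [hstart, max_eq_left hlt.le, ncard_arrivals_Ioc hcount hl, busyIndicator, if_neg (by omega)]
    omega

/-- Counting arrivals from the arrival of customer `n` on. -/
lemma countIs_shift_iff {n k : ℕ} {t : ℝ} (ht : 0 ≤ t) :
    CountIs (fun m => x (n + 1 + m)) t k ↔ CountIs x (arrivalTime x n + t) (n + 1 + k) := by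
  refine ⟨fun hc m => ?_, fun hc m => ?_⟩
  · rcases le_or_gt m n with hm | hm
    · have := (arrivalTime_strictMono h.interarrival_pos).monotone hm
      exact ⟨fun _ => by omega, fun _ => by linarith⟩
    · obtain ⟨j, rfl⟩ := Nat.exists_eq_add_of_le (Nat.succ_le_of_lt hm)
      rw [Nat.succ_eq_add_one, arrivalTime_add, add_le_add_iff_left, hc j]; omega
  · rw [← add_le_add_iff_left (arrivalTime x n), ← arrivalTime_add, hc]; omega

lemma numberLeftBehind_eq_iff {n k : ℕ} :
    numberLeftBehind x s n = k ↔ CountIs (fun m => x (n + 1 + m)) (sojournTime x s n) k := by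
  rw [h.countIs_shift_iff (sojournTime_nonneg h.service_nonneg n), ← departureTime_eq]
  obtain ⟨l, hl⟩ := h.exists_countIs (departureTime x s n)
  have hl1 := hl.succ_le (h.arrivalTime_le_departureTime n)
  rw [h.numberLeftBehind_eq hl]
  refine ⟨?_, fun hc => ?_⟩
  · rintro rfl
    rwa [Nat.add_sub_cancel' hl1]
  · have := hl.unique hc
    omega

lemma arrivalsDuringService_eq_iff {n k : ℕ} :
    arrivalsDuringService x s n = k ↔ ∃ j, CountIs (fun m => x (n + 1 + m)) (waitingTime x s n) j ∧
      CountIs (fun m => x (n + 1 + m)) (waitingTime x s n + s n) (j + k) := by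
  have hw := waitingTime_nonneg x s n
  have hs := h.service_nonneg n
  simp only [h.countIs_shift_iff hw, h.countIs_shift_iff (add_nonneg hw hs)]
  rw [← serviceStart_eq, ← add_assoc, ← serviceStart_eq, ← departureTime, arrivalsDuringService]
  obtain ⟨k', hk⟩ := h.exists_countIs (serviceStart x s n)
  obtain ⟨l, hl⟩ := h.exists_countIs (departureTime x s n)
  have hk1 : n + 1 ≤ k' := hk.succ_le (by rw [serviceStart_eq]; linarith)
  have hkl := hk.mono hl (by rw [departureTime]; linarith)
  rw [ncard_arrivals_Ioc hk hl]
  refine ⟨?_, ?_⟩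
  · rintro rfl
    obtain ⟨j, rfl⟩ := Nat.exists_eq_add_of_le hk1
    refine ⟨j, hk, ?_⟩
    rwa [← add_assoc, Nat.add_sub_cancel' hkl]
  · rintro ⟨j, h1, h2⟩
    have := hk.unique h1
    have := hl.unique h2
    omega

end RegularPath

/-! ### Little's law along a sample path -/

lemma numberInSystem_eq_sum {x s : ℕ → ℝ} {k : ℕ} {t T : ℝ} (hk : CountIs x T k) (ht : t ≤ T) :
    (numberInSystem x s t : ℝ) = ∑ n ∈ Finset.range k,
      (Set.Ico (arrivalTime x n) (departureTime x s n)).indicator 1 t := by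
  classical
  have : {n : ℕ | arrivalTime x n ≤ t ∧ t < departureTime x s n} =
      ((Finset.range k).filter fun n => t ∈ Set.Ico (arrivalTime x n) (departureTime x s n) :
        Finset ℕ) := by
    ext n
    simp only [Set.mem_ofPred_eq, Finset.coe_filter, Finset.mem_range, Set.mem_Ico]
    exact ⟨fun hn => ⟨(hk n).1 (hn.1.trans ht), hn⟩, fun hn => hn.2⟩
  rw [numberInSystem, this, Set.ncard_coe_finset, Finset.card_filter]
  push_cast
  refine Finset.sum_congr rfl fun n _ => ?_
  simp [Set.indicator_apply]

lemma integral_numberInSystem {x s : ℕ → ℝ} {k : ℕ} {T : ℝ} (hk : CountIs x T k) (hT : 0 ≤ T) :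
    ∫ t in (0 : ℝ)..T, (numberInSystem x s t : ℝ) = ∑ n ∈ Finset.range k,
      volume.real (Set.Ico (arrivalTime x n) (departureTime x s n) ∩ Set.Ioc 0 T) := by
  rw [intervalIntegral.integral_of_le hT, setIntegral_congr_fun measurableSet_Ioc
    (fun t ht => numberInSystem_eq_sum hk ht.2), integral_finsetSum]
  · refine Finset.sum_congr rfl fun n _ => ?_
    rw [integral_indicator_one measurableSet_Ico, measureReal_restrict_apply measurableSet_Ico]
  · intro n _
    exact (integrable_const (1 : ℝ)).indicator measurableSet_Ico

namespace RegularPath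

variable {x s : ℕ → ℝ} (h : RegularPath x s)
include h

/-- The area under the number in system up to time `T` is at most the total sojourn time of the
customers who arrived by time `T`. -/
lemma integral_numberInSystem_le {k : ℕ} {T : ℝ} (hk : CountIs x T k) (hT : 0 ≤ T) :
    ∫ t in (0 : ℝ)..T, (numberInSystem x s t : ℝ) ≤ ∑ n ∈ Finset.range k, sojournTime x s n := by
  rw [_root_.MG1.integral_numberInSystem hk hT]
  refine Finset.sum_le_sum fun n _ => ?_
  refine (measureReal_mono Set.inter_subset_left (by simp)).trans ?_
  rw [Real.volume_real_Ico_of_le (h.arrivalTime_le_departureTime n), departureTime_eq]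
  linarith

/-- The area under the number in system up to time `T` is at least the total sojourn time of the
customers who departed by time `T`. -/
lemma sum_sojournTime_le_integral {k : ℕ} {T : ℝ}
    (hk : ∀ m, departureTime x s m ≤ T ↔ m < k) (hT : 0 ≤ T) :
    ∑ n ∈ Finset.range k, sojournTime x s n ≤ ∫ t in (0 : ℝ)..T, (numberInSystem x s t : ℝ) := by
  obtain ⟨l, hl⟩ := h.exists_countIs T
  rw [_root_.MG1.integral_numberInSystem hl hT]
  have hkl : k ≤ l := by
    by_contra hc
    push Not at hc
    exact lt_irrefl l ((hl l).1 ((h.arrivalTime_le_departureTime l).trans ((hk l).2 hc)))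
  refine (Finset.sum_le_sum fun n hn => ?_).trans (Finset.sum_le_sum_of_subset_of_nonneg
    (Finset.range_mono hkl) fun _ _ _ => measureReal_nonneg)
  have hsub : Set.Ico (arrivalTime x n) (departureTime x s n) ⊆ Set.Ioc 0 T := fun t ht =>
    ⟨(arrivalTime_pos h.interarrival_pos n).trans_le ht.1,
      ht.2.le.trans ((hk n).2 (Finset.mem_range.1 hn))⟩
  rw [Set.inter_eq_left.2 hsub, Real.volume_real_Ico_of_le (h.arrivalTime_le_departureTime n),
    departureTime_eq]
  linarith

end RegularPath

lemma tendsto_atTop_of_tendsto_div {b : ℕ → ℝ} {β : ℝ} (hβ : 0 < β)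
    (h : Tendsto (fun n : ℕ => b n / n) atTop (𝓝 β)) : Tendsto b atTop atTop := by
  have := h.pos_mul_atTop hβ tendsto_natCast_atTop_atTop
  refine this.congr' ?_
  filter_upwards [eventually_gt_atTop 0] with n hn
  have : (n : ℝ) ≠ 0 := by positivity
  field_simp

lemma tendsto_pred_div {b : ℕ → ℝ} {β : ℝ} (h : Tendsto (fun n : ℕ => b n / n) atTop (𝓝 β)) :
    Tendsto (fun n : ℕ => b (n - 1) / n) atTop (𝓝 β) := by
  rw [← tendsto_add_atTop_iff_nat 1]
  have h1 := h.mul (tendsto_natCast_div_add_atTop (1 : ℝ))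
  rw [mul_one] at h1
  refine h1.congr' ?_
  filter_upwards [eventually_gt_atTop 0] with n hn
  have : (n : ℝ) ≠ 0 := by positivity
  simp only [Nat.add_sub_cancel]
  push_cast
  field_simp

/-- If the `n`-th event happens at time about `β n`, then about `t / β` events happen by time
`t`. -/
lemma tendsto_count_div {b : ℕ → ℝ} {β : ℝ} (hβ : 0 < β)
    (h : Tendsto (fun n : ℕ => b n / n) atTop (𝓝 β)) {K : ℝ → ℕ}
    (hK : ∀ t m, b m ≤ t ↔ m < K t) :
    Tendsto K atTop atTop ∧ Tendsto (fun t => (K t : ℝ) / t) atTop (𝓝 (1 / β)) := by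
  have hKtop : Tendsto K atTop atTop := tendsto_atTop.2 fun m =>
    (eventually_ge_atTop (b m)).mono fun t ht => ((hK t m).1 ht).le
  refine ⟨hKtop, ?_⟩
  have key : Tendsto (fun t => t / (K t : ℝ)) atTop (𝓝 β) := by
    refine tendsto_of_tendsto_of_tendsto_of_le_of_le' ((tendsto_pred_div h).comp hKtop)
      (h.comp hKtop) ?_ ?_
    · filter_upwards [hKtop.eventually_gt_atTop 0] with t ht
      have : b (K t - 1) ≤ t := (hK t _).2 (by omega)
      simp only [Function.comp_apply]
      gcongr
    · refine Eventually.of_forall fun t => ?_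
      have : t ≤ b (K t) := le_of_not_ge fun hc => lt_irrefl _ ((hK t _).1 hc)
      simp only [Function.comp_apply]
      gcongr
  have := key.inv₀ hβ.ne'
  simpa [one_div] using this

/-- Little's law along a sample path: if customers arrive at rate `lam` and the sojourn times
average to `v`, then the number in system averages to `lam * v`. -/
lemma RegularPath.tendsto_average_numberInSystem {x s : ℕ → ℝ} (h : RegularPath x s)
    {lam v : ℝ} (hlam : 0 < lam)
    (hA : Tendsto (fun n : ℕ => arrivalTime x n / n) atTop (𝓝 (1 / lam)))
    (hV : Tendsto (fun n : ℕ => (∑ i ∈ Finset.range n, sojournTime x s i) / n) atTop (𝓝 v)) :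
    Tendsto (fun T : ℝ => (1 / T) * ∫ t in (0 : ℝ)..T, (numberInSystem x s t : ℝ)) atTop
      (𝓝 (lam * v)) := by
  have hlam' : 0 < 1 / lam := by positivity
  -- the sojourn time of customer `n` is `o(n)`, so departures happen at the same rate as arrivals
  have hVn : Tendsto (fun n : ℕ => sojournTime x s n / n) atTop (𝓝 0) := by
    have h1 := (tendsto_add_atTop_iff_nat 1).2 hV
    have h2 := h1.mul ((tendsto_natCast_div_add_atTop (1 : ℝ)).inv₀ one_ne_zero)
    have h3 := h2.sub hV
    rw [inv_one, mul_one, sub_self] at h3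
    refine h3.congr' ?_
    filter_upwards [eventually_gt_atTop 0] with n hn
    have : (n : ℝ) ≠ 0 := by positivity
    rw [Finset.sum_range_succ]
    push_cast
    field_simp
    ring
  have hD : Tendsto (fun n : ℕ => departureTime x s n / n) atTop (𝓝 (1 / lam)) := by
    have := hA.add hVn
    rw [add_zero] at this
    refine this.congr fun n => ?_
    rw [departureTime_eq, add_div]
  choose N hN using h.exists_countIs
  choose K hK using exists_count (departureTime_mono (x := x) h.service_nonneg)
    (tendsto_atTop_of_tendsto_div hlam' hD)
  have aux : ∀ {b : ℕ → ℝ} {K : ℝ → ℕ}, Tendsto (fun n : ℕ => b n / n) atTop (𝓝 (1 / lam)) →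
      (∀ t m, b m ≤ t ↔ m < K t) →
      Tendsto (fun T => (1 / T) * ∑ i ∈ Finset.range (K T), sojournTime x s i) atTop
        (𝓝 (lam * v)) := by
    intro b K hb hK
    obtain ⟨h1, h2⟩ := tendsto_count_div hlam' hb hK
    have := h2.mul (hV.comp h1)
    rw [one_div_one_div] at this
    refine this.congr' ?_
    filter_upwards [h1.eventually_gt_atTop 0, eventually_gt_atTop 0] with T hT hT0
    have : (K T : ℝ) ≠ 0 := by positivity
    simp only [Function.comp_apply]
    field_simp
  refine tendsto_of_tendsto_of_tendsto_of_le_of_le' (aux hD hK) (aux hA hN) ?_ ?_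
  · filter_upwards [eventually_ge_atTop 0] with T hT
    exact mul_le_mul_of_nonneg_left (h.sum_sojournTime_le_integral (hK T) hT) (by positivity)
  · filter_upwards [eventually_ge_atTop 0] with T hT
    exact mul_le_mul_of_nonneg_left (h.integral_numberInSystem_le (hN T) hT) (by positivity)

/-! ### Independence of functions of disjoint blocks of variables -/

lemma indepFun_of_disjoint {Ω ι : Type*} [MeasurableSpace Ω] {P : Measure Ω}
    {Z : ι → Ω → ℝ} (hZ : iIndepFun Z P) (hm : ∀ i, Measurable (Z i)) {A B : Set ι}
    (hAB : Disjoint A B) :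
    IndepFun (fun ω (i : A) => Z i ω) (fun ω (i : B) => Z i ω) P := by
  have h := indep_iSup_of_disjoint (fun i => (hm i).comap_le) hZ.iIndep hAB
  rw [IndepFun_iff_Indep]
  refine indep_of_indep_of_le_left (indep_of_indep_of_le_right h ?_) ?_
  all_goals
    rw [MeasurableSpace.pi, MeasurableSpace.comap_iSup]
    refine iSup_le fun i => ?_
    rw [MeasurableSpace.comap_comp]
    exact le_iSup₂_of_le (i : ι) i.2 le_rfl

lemma indepFun_of_dependsOn {Ω ι β γ : Type*} [MeasurableSpace Ω] [MeasurableSpace β]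
    [MeasurableSpace γ] {P : Measure Ω} {Z : ι → Ω → ℝ} (hZ : iIndepFun Z P)
    (hm : ∀ i, Measurable (Z i)) {F : (ι → ℝ) → β} {G : (ι → ℝ) → γ} (hF : Measurable F)
    (hG : Measurable G) {A B : Set ι} (hFA : DependsOn F A) (hGB : DependsOn G B)
    (hAB : Disjoint A B) :
    IndepFun (fun ω => F fun i => Z i ω) (fun ω => G fun i => Z i ω) P := by
  classical
  -- a function of the coordinates in `A` does not change when the others are replaced by `0`
  have aux : ∀ A : Set ι,
      Measurable (fun (z : A → ℝ) (i : ι) => if h : i ∈ A then z ⟨i, h⟩ else 0) :=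
    fun A => measurable_pi_lambda _ fun i => by
      by_cases h : i ∈ A
      · simpa [h] using measurable_pi_apply (⟨i, h⟩ : A)
      · simp [h]
  have h := (indepFun_of_disjoint hZ hm hAB).comp (hF.comp (aux A)) (hG.comp (aux B))
  convert h using 1
  · ext ω
    exact hFA fun i hi => by simp [hi]
  · ext ω
    exact hGB fun i hi => by simp [hi]

lemma iIndepFun_of_dependsOn {Ω ι α β : Type*} [MeasurableSpace Ω] [MeasurableSpace β]
    {P : Measure Ω} {Z : ι → Ω → ℝ} (hZ : iIndepFun Z P) (hm : ∀ i, Measurable (Z i))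
    {F : α → (ι → ℝ) → β} (hF : ∀ n, Measurable (F n)) {A : α → Set ι}
    (hFA : ∀ n, DependsOn (F n) (A n)) (hA : Pairwise (Function.onFun Disjoint A)) :
    iIndepFun (fun n ω => F n fun i => Z i ω) P := by
  classical
  have := hZ.isProbabilityMeasure
  rw [iIndepFun_iff_measure_inter_preimage_eq_mul]
  intro S
  induction S using Finset.induction_on with
  | empty => intro sets _; simp
  | insert a S ha ih =>
    intro sets hsets
    have hG : Measurable fun (z : ι → ℝ) (n : S) => F n z := measurable_pi_lambda _ fun n => hF n
    have hGdep : DependsOn (fun (z : ι → ℝ) (n : S) => F n z) (⋃ n ∈ S, A n) :=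
      fun x y h => funext fun n => hFA n fun i hi =>
        h i (Set.mem_iUnion₂.2 ⟨n, n.2, hi⟩)
    have hdisj : Disjoint (A a) (⋃ n ∈ S, A n) := by
      simp only [Set.disjoint_iUnion_right]
      exact fun n hn => hA fun h => ha (h ▸ hn)
    have hind := indepFun_of_dependsOn hZ hm (hF a) hG (hFA a) hGdep hdisj
    have h1 := hind.measure_inter_preimage_eq_mul (sets a)
      (Set.univ.pi fun n : S => sets n) (hsets a (Finset.mem_insert_self a S))
      (MeasurableSet.univ_pi fun n => hsets n (Finset.mem_insert_of_mem n.2))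
    have h2 : (fun ω (n : S) => F n fun i => Z i ω) ⁻¹' (Set.univ.pi fun n : S => sets n) =
        ⋂ n ∈ S, (fun ω => F n fun i => Z i ω) ⁻¹' sets n := by
      ext ω; simp
    rw [h2, ih fun n hn => hsets n (Finset.mem_insert_of_mem hn)] at h1
    rw [Finset.set_biInter_insert, Finset.prod_insert ha, h1]

/-! ### The maximal ergodic inequality -/

section Maximal

variable {Y : Type*} (T : Y → Y) (g : Y → ℝ)

/-- The largest of the Birkhoff sums of `g` along `T` of lengths `0, …, n`. -/
noncomputable def maxBirkhoffSum : ℕ → Y → ℝ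
  | 0 => fun _ => 0
  | n + 1 => fun y => max 0 (g y + maxBirkhoffSum n (T y))

lemma maxBirkhoffSum_nonneg : ∀ n y, 0 ≤ maxBirkhoffSum T g n y
  | 0, _ => le_rfl
  | _ + 1, _ => le_max_left _ _

lemma maxBirkhoffSum_le_succ (n : ℕ) (y : Y) :
    maxBirkhoffSum T g n y ≤ maxBirkhoffSum T g (n + 1) y := by
  induction n generalizing y with
  | zero => exact maxBirkhoffSum_nonneg T g 1 y
  | succ n ih =>
    rw [maxBirkhoffSum, maxBirkhoffSum]
    exact max_le_max le_rfl (add_le_add le_rfl (ih _))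

lemma birkhoffSum_le_maxBirkhoffSum (n : ℕ) (y : Y) :
    birkhoffSum T g n y ≤ maxBirkhoffSum T g n y := by
  induction n generalizing y with
  | zero => simp [maxBirkhoffSum]
  | succ n ih =>
    rw [birkhoffSum_succ', maxBirkhoffSum]
    exact le_max_of_le_right (add_le_add le_rfl (ih _))

variable {T g} [MeasurableSpace Y] {ν : Measure Y}

lemma measurable_maxBirkhoffSum (hT : Measurable T) (hg : Measurable g) (n : ℕ) :
    Measurable (maxBirkhoffSum T g n) := by
  induction n with
  | zero => exact measurable_const
  | succ n ih => exact measurable_const.max (hg.add (ih.comp hT))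

lemma integrable_maxBirkhoffSum (hT : MeasurePreserving T ν ν) (hg : Integrable g ν) (n : ℕ) :
    Integrable (maxBirkhoffSum T g n) ν := by
  induction n with
  | zero => exact integrable_zero _ _ _
  | succ n ih => exact (integrable_zero _ _ _).sup (hg.add (hT.integrable_comp_of_integrable ih))

/-- The maximal ergodic theorem: where the maximum `F (n + 1)` is positive, `g` is
`F (n + 1) - F n ∘ T`, and `F n ∘ T` has the integral of `F n ≤ F (n + 1)`. -/
lemma setIntegral_maxBirkhoffSum_pos_nonneg (hT : MeasurePreserving T ν ν) (hgm : Measurable g)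
    (hg : Integrable g ν) (n : ℕ) : 0 ≤ ∫ y in {y | 0 < maxBirkhoffSum T g (n + 1) y}, g y ∂ν := by
  set F := maxBirkhoffSum T g
  have hFm := measurable_maxBirkhoffSum hT.measurable hgm
  have hFi := integrable_maxBirkhoffSum hT hg
  have hFT : Integrable (fun y => F n (T y)) ν := hT.integrable_comp_of_integrable (hFi n)
  have hs : MeasurableSet {y | 0 < F (n + 1) y} := measurableSet_lt measurable_const (hFm _)
  have h1 : ∫ y in {y | 0 < F (n + 1) y}, g y ∂ν =
      ∫ y in {y | 0 < F (n + 1) y}, (F (n + 1) y - F n (T y)) ∂ν := by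
    refine setIntegral_congr_fun hs fun y hy => ?_
    have hy' : 0 < max 0 (g y + F n (T y)) := hy
    have : F (n + 1) y = g y + F n (T y) := by
      change max 0 (g y + F n (T y)) = _
      rcases lt_max_iff.1 hy' with h | h
      · exact absurd h (lt_irrefl _)
      · exact max_eq_right h.le
    simp only [this]; ring
  rw [h1, integral_sub (hFi _).integrableOn hFT.integrableOn]
  have h2 : ∫ y in {y | 0 < F (n + 1) y}, F (n + 1) y ∂ν = ∫ y, F (n + 1) y ∂ν := by
    refine setIntegral_eq_integral_of_forall_compl_eq_zero fun y hy => ?_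
    exact le_antisymm (not_lt.1 hy) (maxBirkhoffSum_nonneg T g _ y)
  have h3 : ∫ y in {y | 0 < F (n + 1) y}, F n (T y) ∂ν ≤ ∫ y, F n (T y) ∂ν :=
    setIntegral_le_integral hFT (Eventually.of_forall fun y => maxBirkhoffSum_nonneg T g n _)
  have h4 : ∫ y, F n (T y) ∂ν = ∫ y, F n y ∂ν := by
    rw [← integral_map hT.measurable.aemeasurable (by rw [hT.map_eq]; exact (hFi n).1), hT.map_eq]
  have h5 : ∫ y, F n y ∂ν ≤ ∫ y, F (n + 1) y ∂ν :=
    integral_mono (hFi _) (hFi _) fun y => maxBirkhoffSum_le_succ T g n y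
  linarith

/-- The maximal ergodic inequality: the Birkhoff averages of a nonnegative `f` exceed `ε` at some
time with probability at most `(∫ f) / ε`. -/
lemma measureReal_exists_birkhoffSum_gt [IsProbabilityMeasure ν] (hT : MeasurePreserving T ν ν)
    {f : Y → ℝ} (hfm : Measurable f) (hf : Integrable f ν) (hf0 : 0 ≤ f) {ε : ℝ} (hε : 0 < ε) :
    ν.real {y | ∃ n : ℕ, ε * n < birkhoffSum T f n y} ≤ (∫ y, f y ∂ν) / ε := by
  set g : Y → ℝ := fun y => f y - ε
  have hgi : Integrable g ν := hf.sub (integrable_const ε)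
  have hgm : Measurable g := hfm.sub measurable_const
  set E : ℕ → Set Y := fun n => {y | 0 < maxBirkhoffSum T g (n + 1) y}
  have hEm : ∀ n, MeasurableSet (E n) := fun n =>
    measurableSet_lt measurable_const (measurable_maxBirkhoffSum hT.measurable hgm _)
  have hEmono : Monotone E := monotone_nat_of_le_succ fun n y hy =>
    lt_of_lt_of_le hy (maxBirkhoffSum_le_succ T g (n + 1) y)
  have hsub : {y | ∃ n : ℕ, ε * n < birkhoffSum T f n y} ⊆ ⋃ n, E n := by
    rintro y ⟨n, hn⟩
    refine Set.mem_iUnion.2 ⟨n, ?_⟩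
    have h1 : birkhoffSum T g n y = birkhoffSum T f n y - ε * n := by
      simp [birkhoffSum, g, Finset.sum_sub_distrib, mul_comm]
    have h2 := birkhoffSum_le_maxBirkhoffSum T g n y
    have h3 := maxBirkhoffSum_le_succ T g n y
    change 0 < maxBirkhoffSum T g (n + 1) y
    linarith
  have hbound : ∀ n, ν.real (E n) ≤ (∫ y, f y ∂ν) / ε := fun n => by
    rw [le_div_iff₀ hε]
    have h1 := setIntegral_maxBirkhoffSum_pos_nonneg hT hgm hgi n
    have h2 : ∫ y in E n, g y ∂ν = ∫ y in E n, f y ∂ν - ν.real (E n) * ε := by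
      simp only [g]
      rw [integral_sub hf.integrableOn (integrable_const ε).integrableOn]
      simp
    have h3 : ∫ y in E n, f y ∂ν ≤ ∫ y, f y ∂ν :=
      setIntegral_le_integral hf (Eventually.of_forall hf0)
    change 0 ≤ ∫ y in E n, g y ∂ν at h1
    linarith
  have hlim : Tendsto (fun n => ν.real (E n)) atTop (𝓝 (ν.real (⋃ n, E n))) :=
    (ENNReal.tendsto_toReal (measure_ne_top _ _)).comp (tendsto_measure_iUnion_atTop hEmono)
  exact (measureReal_mono hsub).trans (le_of_tendsto' hlim hbound)

end Maximal

/-! ### Averages along the two-sided Bernoulli shift -/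

section TwoSided

variable {κ : Measure ℝ} [IsProbabilityMeasure κ]

/-- The shift of two-sided sequences. -/
def shift (y : ℤ → ℝ) : ℤ → ℝ := fun i => y (i + 1)

lemma shift_iterate (n : ℕ) (y : ℤ → ℝ) : shift^[n] y = fun i => y (i + n) := by
  induction n generalizing y with
  | zero => simp
  | succ n ih =>
    rw [Function.iterate_succ_apply, ih]
    ext i
    simp only [shift]
    congr 1
    push_cast; ring

lemma measurePreserving_shift :
    MeasurePreserving shift (Measure.infinitePi fun _ : ℤ => κ)
      (Measure.infinitePi fun _ : ℤ => κ) where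
  measurable := measurable_pi_lambda _ fun i => measurable_pi_apply (i + 1)
  map_eq := Measure.map_infinitePi_infinitePi_of_inj (P := fun _ : ℤ => κ)
    (f := fun i : ℤ => i + 1) (add_left_injective 1)

/-- A Birkhoff sum over `m * J` steps, sorted by the residues modulo `m`. -/
lemma birkhoffSum_mul {Y : Type*} (T : Y → Y) (f : Y → ℝ) (m J : ℕ) (y : Y) :
    birkhoffSum T f (m * J) y =
      ∑ r ∈ Finset.range m, ∑ j ∈ Finset.range J, f (T^[m * j + r] y) := by
  induction J with
  | zero => simp
  | succ J ih =>
    simp only [Finset.sum_range_succ]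
    rw [Finset.sum_add_distrib, ← ih, Nat.mul_succ]
    simp only [birkhoffSum]
    rw [Finset.sum_range_add]

lemma identDistrib_iterate_shift {f : (ℤ → ℝ) → ℝ} (hf : Measurable f) (n : ℕ) :
    IdentDistrib (fun y => f (shift^[n] y)) f (Measure.infinitePi fun _ : ℤ => κ)
      (Measure.infinitePi fun _ : ℤ => κ) := by
  have hT := (measurePreserving_shift (κ := κ)).iterate n
  refine ⟨(hf.comp hT.measurable).aemeasurable, hf.aemeasurable, ?_⟩
  change Measure.map (f ∘ _) _ = _
  rw [← Measure.map_map hf hT.measurable, hT.map_eq]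

/-- The strong law of large numbers along the shift, for a function of finitely many coordinates:
its values at times of the same residue modulo the length of the block are independent. -/
lemma tendsto_birkhoffSum_div_of_dependsOn {f : (ℤ → ℝ) → ℝ} (hf : Measurable f) (hf0 : 0 ≤ f)
    (hfi : Integrable f (Measure.infinitePi fun _ : ℤ => κ)) {m : ℕ} (hm : 0 < m)
    (hdep : DependsOn f (Set.Ico (-m : ℤ) 0)) :
    ∀ᵐ y ∂(Measure.infinitePi fun _ : ℤ => κ), Tendsto (fun n : ℕ => birkhoffSum shift f n y / n)
      atTop (𝓝 (∫ y, f y ∂(Measure.infinitePi fun _ : ℤ => κ))) := by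
  set ν : Measure (ℤ → ℝ) := Measure.infinitePi fun _ : ℤ => κ
  have hdep' : ∀ n : ℕ, DependsOn (fun y => f (shift^[n] y)) (Set.Ico ((n : ℤ) - m) n) := by
    intro n y z hyz
    refine hdep fun i hi => ?_
    rw [shift_iterate, shift_iterate]
    exact hyz _ ⟨by linarith [hi.1], by linarith [hi.2]⟩
  have hmeas : ∀ n : ℕ, Measurable fun y => f (shift^[n] y) := fun n =>
    hf.comp ((measurePreserving_shift (κ := κ)).iterate n).measurable
  have hcoord : iIndepFun (fun (i : ℤ) (y : ℤ → ℝ) => y i) ν :=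
    iIndepFun_infinitePi (P := fun _ : ℤ => κ) (X := fun _ x => x) fun _ => measurable_id
  have hpair : ∀ r j j' : ℕ, j < j' →
      IndepFun (fun y => f (shift^[m * j + r] y)) (fun y => f (shift^[m * j' + r] y)) ν := by
    intro r j j' hjj
    refine indepFun_of_dependsOn hcoord measurable_pi_apply (hmeas _) (hmeas _) (hdep' _)
      (hdep' _) ?_
    rw [Set.disjoint_left]
    intro i hi hi'
    obtain ⟨d, rfl⟩ := Nat.exists_eq_add_of_lt hjj
    have h1 := hi.2
    have h2 := hi'.1
    push_cast at h1 h2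
    have : (0 : ℤ) ≤ m * d := by positivity
    nlinarith
  have hres : ∀ r : ℕ, ∀ᵐ y ∂ν, Tendsto (fun J : ℕ =>
      (∑ j ∈ Finset.range J, f (shift^[m * j + r] y)) / J) atTop (𝓝 (∫ y, f y ∂ν)) := by
    intro r
    have hid := fun j : ℕ => identDistrib_iterate_shift (κ := κ) hf (m * j + r)
    have := strong_law_ae_real (μ := ν) (fun j y => f (shift^[m * j + r] y))
      ((hid 0).integrable_iff.2 hfi)
      (fun j j' hjj => by
        rcases Nat.lt_or_gt_of_ne hjj with h | h
        · exact hpair r j j' h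
        · exact (hpair r j' j h).symm)
      (fun j => (hid j).trans (hid 0).symm)
    rw [(hid 0).integral_eq] at this
    exact this
  filter_upwards [ae_all_iff.2 hres] with y hy
  refine tendsto_div_of_monotone_of_exists_subseq_tendsto_div _ _ ?_ fun a ha =>
    ⟨fun J => m * J, ?_, ?_, ?_⟩
  -- the Birkhoff sums of a nonnegative function are monotone, so multiples of `m` are enough
  · refine monotone_nat_of_le_succ fun n => ?_
    rw [birkhoffSum_succ]
    linarith [show (0 : ℝ) ≤ f (shift^[n] y) from hf0 _]
  · filter_upwards [eventually_ge_atTop (Nat.ceil (1 / (a - 1)))] with J hJ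
    have h1 : 1 / (a - 1) ≤ J := Nat.ceil_le.1 hJ
    rw [div_le_iff₀ (by linarith)] at h1
    push_cast
    have : (0 : ℝ) ≤ m := by positivity
    nlinarith
  · exact tendsto_id.const_mul_atTop' hm
  · have h1 : Tendsto (fun J : ℕ => (m : ℝ)⁻¹ * ∑ r ∈ Finset.range m,
        (∑ j ∈ Finset.range J, f (shift^[m * j + r] y)) / J) atTop
        (𝓝 ((m : ℝ)⁻¹ * ∑ r ∈ Finset.range m, ∫ y, f y ∂ν)) :=
      (tendsto_finsetSum _ fun r _ => hy r).const_mul _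
    have hm' : (m : ℝ) ≠ 0 := by positivity
    have h2 : (m : ℝ)⁻¹ * ∑ r ∈ Finset.range m, ∫ y, f y ∂ν = ∫ y, f y ∂ν := by
      rw [Finset.sum_const, Finset.card_range, nsmul_eq_mul, inv_mul_cancel_left₀ hm']
    rw [h2] at h1
    refine h1.congr fun J => ?_
    rw [birkhoffSum_mul, ← Finset.sum_div]
    push_cast
    rw [inv_mul_eq_div, div_div, mul_comm (J : ℝ)]

/-! ### The stationary waiting time -/

/-- The state at time `0` of Lindley's recursion started from `0` at time `-n` and driven by the
two-sided sequence `y`. -/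
noncomputable def lindleyFrom (n : ℕ) (y : ℤ → ℝ) : ℝ := lindley (fun k => y ((k : ℤ) - n)) n

/-- The state at time `0` of Lindley's recursion started in the infinite past. As `lindleyFrom` is
monotone in the starting time, this is its limit, provided that it is bounded. -/
noncomputable def stationaryLindley (y : ℤ → ℝ) : ℝ := ⨆ n, lindleyFrom n y

lemma lindley_congr {u v : ℕ → ℝ} {n : ℕ} (h : ∀ k < n, u k = v k) :
    lindley u n = lindley v n := by
  induction n with
  | zero => rfl
  | succ n ih => rw [lindley, lindley, ih fun k hk => h k (by omega), h n (by omega)]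

/-- Starting Lindley's recursion one step earlier can only increase its later values. -/
lemma lindley_shift_le (u : ℕ → ℝ) (n : ℕ) :
    lindley (fun k => u (k + 1)) n ≤ lindley u (n + 1) := by
  induction n with
  | zero => exact lindley_nonneg u 1
  | succ n ih =>
    rw [lindley, lindley]
    exact max_le_max le_rfl (add_le_add ih le_rfl)

/-- Lindley's recursion is bounded by the partial sums of its increments taken backwards. -/
lemma lindley_le {u : ℕ → ℝ} {n : ℕ} {C : ℝ} (hC : 0 ≤ C)
    (h : ∀ k ≤ n, ∑ i ∈ Finset.range k, u (n - 1 - i) ≤ C) : lindley u n ≤ C := by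
  induction n generalizing C with
  | zero => exact hC
  | succ n ih =>
    rw [lindley]
    refine max_le hC ?_
    have : lindley u n ≤ C - u n := by
      refine ih (by simpa using h 1 (by omega)) fun k hk => ?_
      have := h (k + 1) (by omega)
      rw [Finset.sum_range_succ'] at this
      simp only [Nat.add_sub_cancel, Nat.sub_zero] at this
      have h2 : ∑ i ∈ Finset.range k, u (n - (i + 1)) = ∑ i ∈ Finset.range k, u (n - 1 - i) :=
        Finset.sum_congr rfl fun i _ => by congr 1; omega
      linarith
    linarith

lemma measurable_lindley {α : Type*} [MeasurableSpace α] {u : ℕ → α → ℝ}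
    (hu : ∀ k, Measurable (u k)) (n : ℕ) : Measurable fun a => lindley (fun k => u k a) n := by
  induction n with
  | zero => exact measurable_const
  | succ n ih => exact measurable_const.max (ih.add (hu n))

lemma measurable_lindleyFrom (n : ℕ) : Measurable (lindleyFrom n) :=
  measurable_lindley (fun _ => measurable_pi_apply _) n

lemma measurable_stationaryLindley : Measurable stationaryLindley :=
  Measurable.iSup measurable_lindleyFrom

lemma lindleyFrom_nonneg (n : ℕ) (y : ℤ → ℝ) : 0 ≤ lindleyFrom n y := lindley_nonneg _ n

lemma stationaryLindley_nonneg (y : ℤ → ℝ) : 0 ≤ stationaryLindley y :=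
  Real.iSup_nonneg fun n => lindleyFrom_nonneg n y

lemma lindleyFrom_mono (y : ℤ → ℝ) : Monotone fun n => lindleyFrom n y :=
  monotone_nat_of_le_succ fun n => by
    refine (lindley_congr fun k _ => ?_).trans_le
      (lindley_shift_le (fun k => y ((k : ℤ) - (n + 1 : ℕ))) n)
    congr 1; push_cast; ring

lemma dependsOn_lindleyFrom (n : ℕ) : DependsOn (lindleyFrom n) (Set.Ico (-n : ℤ) 0) :=
  fun y z h => lindley_congr fun k hk => h _ ⟨by omega, by omega⟩

/-- Lindley's recursion started at time `0` is the recursion started `n` steps back, seen from time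
`n`. -/
lemma lindleyFrom_iterate_shift (n : ℕ) (y : ℤ → ℝ) :
    lindleyFrom n (shift^[n] y) = lindley (fun k => y k) n := by
  rw [lindleyFrom, shift_iterate]
  simp

/-- Under a negative drift Lindley's recursion started in the infinite past is finite. -/
lemma ae_bddAbove_lindleyFrom (hκ : Integrable id κ) (hneg : ∫ x, x ∂κ < 0) :
    ∀ᵐ y ∂(Measure.infinitePi fun _ : ℤ => κ), BddAbove (Set.range fun n => lindleyFrom n y) := by
  set ν : Measure (ℤ → ℝ) := Measure.infinitePi fun _ : ℤ => κ
  have hlaw : ∀ i : ℤ, IdentDistrib (fun y : ℤ → ℝ => y i) id ν κ := fun i =>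
    ⟨(measurable_pi_apply i).aemeasurable, aemeasurable_id, by
      rw [Measure.map_id]; exact Measure.infinitePi_map_eval (fun _ : ℤ => κ) i⟩
  have hcoord : iIndepFun (fun (i : ℤ) (y : ℤ → ℝ) => y i) ν :=
    iIndepFun_infinitePi (P := fun _ : ℤ => κ) (X := fun _ x => x) fun _ => measurable_id
  have hslln := strong_law_ae_real (μ := ν) (fun (i : ℕ) (y : ℤ → ℝ) => y (-(i + 1 : ℤ)))
    ((hlaw _).integrable_iff.2 hκ)
    (fun i j hij => hcoord.indepFun (by omega))
    (fun i => (hlaw _).trans (hlaw _).symm)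
  rw [(hlaw _).integral_eq] at hslln
  filter_upwards [hslln] with y hy
  have hbot : Tendsto (fun n : ℕ => ∑ i ∈ Finset.range n, y (-(i + 1 : ℤ))) atTop atBot := by
    have := hy.neg_mul_atTop hneg tendsto_natCast_atTop_atTop
    refine this.congr' ?_
    filter_upwards [eventually_gt_atTop 0] with n hn
    have : (n : ℝ) ≠ 0 := by positivity
    field_simp
  obtain ⟨C, hC⟩ := bddAbove_range_of_tendsto_atTop_atBot hbot
  refine ⟨max C 0, ?_⟩
  rintro _ ⟨n, rfl⟩
  refine lindley_le (le_max_right _ _) fun k hk => le_max_of_le_left ?_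
  refine le_trans (le_of_eq ?_) (hC ⟨k, rfl⟩)
  refine Finset.sum_congr rfl fun i hi => ?_
  have := Finset.mem_range.1 hi
  congr 1; omega

lemma ae_tendsto_lindleyFrom (hκ : Integrable id κ) (hneg : ∫ x, x ∂κ < 0) :
    ∀ᵐ y ∂(Measure.infinitePi fun _ : ℤ => κ),
      Tendsto (fun n => lindleyFrom n y) atTop (𝓝 (stationaryLindley y)) := by
  filter_upwards [ae_bddAbove_lindleyFrom hκ hneg] with y hy
  exact tendsto_atTop_ciSup (lindleyFrom_mono y) hy

end TwoSided

/-! ### Convergence of the averages of the waiting times -/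

section Average

variable {κ : Measure ℝ} [IsProbabilityMeasure κ]

lemma integrable_lindleyFrom (hκ : Integrable id κ) (hneg : ∫ x, x ∂κ < 0)
    (hint : Integrable stationaryLindley (Measure.infinitePi fun _ : ℤ => κ)) (n : ℕ) :
    Integrable (lindleyFrom n) (Measure.infinitePi fun _ : ℤ => κ) := by
  refine hint.mono' (measurable_lindleyFrom n).aestronglyMeasurable ?_
  filter_upwards [ae_bddAbove_lindleyFrom hκ hneg] with y hy
  rw [Real.norm_of_nonneg (lindleyFrom_nonneg n y)]
  exact le_ciSup hy n

lemma tendsto_integral_lindleyFrom (hκ : Integrable id κ) (hneg : ∫ x, x ∂κ < 0)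
    (hint : Integrable stationaryLindley (Measure.infinitePi fun _ : ℤ => κ)) :
    Tendsto (fun n => ∫ y, lindleyFrom n y ∂(Measure.infinitePi fun _ : ℤ => κ)) atTop
      (𝓝 (∫ y, stationaryLindley y ∂(Measure.infinitePi fun _ : ℤ => κ))) := by
  refine tendsto_integral_of_dominated_convergence stationaryLindley
    (fun n => (measurable_lindleyFrom n).aestronglyMeasurable) hint (fun n => ?_)
    (ae_tendsto_lindleyFrom hκ hneg)
  filter_upwards [ae_bddAbove_lindleyFrom hκ hneg] with y hy
  rw [Real.norm_of_nonneg (lindleyFrom_nonneg n y)]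
  exact le_ciSup hy n

lemma ae_tendsto_birkhoffSum_lindleyFrom (hκ : Integrable id κ) (hneg : ∫ x, x ∂κ < 0)
    (hint : Integrable stationaryLindley (Measure.infinitePi fun _ : ℤ => κ)) (m : ℕ) :
    ∀ᵐ y ∂(Measure.infinitePi fun _ : ℤ => κ),
      Tendsto (fun n : ℕ => birkhoffSum shift (lindleyFrom m) n y / n) atTop
        (𝓝 (∫ y, lindleyFrom m y ∂(Measure.infinitePi fun _ : ℤ => κ))) :=
  tendsto_birkhoffSum_div_of_dependsOn (measurable_lindleyFrom m) (lindleyFrom_nonneg m)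
    (integrable_lindleyFrom hκ hneg hint m) m.succ_pos
    ((dependsOn_lindleyFrom m).mono (Set.Ico_subset_Ico_left (by push_cast; linarith)))

/-- The averages of the stationary process do not exceed its mean in the long run: the part of the
process that depends on the distant past is small in mean, hence its averages are uniformly small
with large probability. -/
lemma ae_eventually_birkhoffSum_stationaryLindley_le (hκ : Integrable id κ)
    (hneg : ∫ x, x ∂κ < 0)
    (hint : Integrable stationaryLindley (Measure.infinitePi fun _ : ℤ => κ)) {ε : ℝ}
    (hε : 0 < ε) :
    ∀ᵐ y ∂(Measure.infinitePi fun _ : ℤ => κ), ∀ᶠ n : ℕ in atTop,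
      birkhoffSum shift stationaryLindley n y / n ≤
        ∫ y, stationaryLindley y ∂(Measure.infinitePi fun _ : ℤ => κ) + 2 * ε := by
  set ν : Measure (ℤ → ℝ) := Measure.infinitePi fun _ : ℤ => κ
  set L := ∫ y, stationaryLindley y ∂ν
  set B : Set (ℤ → ℝ) := {y | ¬ ∀ᶠ n : ℕ in atTop,
    birkhoffSum shift stationaryLindley n y / n ≤ L + 2 * ε}
  change ν B = 0
  have hT := measurePreserving_shift (κ := κ)
  have hbound : ∀ m, ν.real B ≤ (L - ∫ y, lindleyFrom m y ∂ν) / ε := by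
    intro m
    -- truncating at `0` makes the remainder nonnegative also where the supremum is a junk value
    set r : (ℤ → ℝ) → ℝ := fun y => max 0 (stationaryLindley y - lindleyFrom m y)
    have hmi := integrable_lindleyFrom hκ hneg hint m
    have hrae : r =ᵐ[ν] fun y => stationaryLindley y - lindleyFrom m y := by
      filter_upwards [ae_bddAbove_lindleyFrom hκ hneg] with y hy
      exact max_eq_right (sub_nonneg.2 (le_ciSup hy m))
    have hrm : Measurable r :=
      measurable_const.max (measurable_stationaryLindley.sub (measurable_lindleyFrom m))
    have hmax := measureReal_exists_birkhoffSum_gt hT hrm ((hint.sub hmi).congr hrae.symm)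
      (fun y => le_max_left _ _) hε
    rw [integral_congr_ae hrae, integral_sub hint hmi] at hmax
    have hle : ∫ y, lindleyFrom m y ∂ν ≤ L := integral_mono_ae hmi hint <| by
      filter_upwards [ae_bddAbove_lindleyFrom hκ hneg] with y hy using le_ciSup hy m
    refine le_trans (ENNReal.toReal_mono (measure_ne_top _ _) (measure_mono_ae ?_)) hmax
    filter_upwards [ae_tendsto_birkhoffSum_lindleyFrom hκ hneg hint m] with y hy hyB
    have h1 : ∀ᶠ n : ℕ in atTop, birkhoffSum shift (lindleyFrom m) n y / n < L + ε :=
      hy.eventually_lt_const (by linarith)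
    obtain ⟨n, hn1, hn2, hn3⟩ := ((not_eventually.1 hyB).and_eventually
      (h1.and (eventually_gt_atTop 0))).exists
    refine ⟨n, ?_⟩
    have hn : (0 : ℝ) < n := by exact_mod_cast hn3
    rw [not_le, lt_div_iff₀ hn] at hn1
    rw [div_lt_iff₀ hn] at hn2
    have h3 : birkhoffSum shift stationaryLindley n y ≤
        birkhoffSum shift (lindleyFrom m) n y + birkhoffSum shift r n y := by
      simp only [birkhoffSum, ← Finset.sum_add_distrib]
      refine Finset.sum_le_sum fun k _ => ?_
      linarith [le_max_right 0 (stationaryLindley (shift^[k] y) - lindleyFrom m (shift^[k] y))]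
    change ε * n < birkhoffSum shift r n y
    linarith
  have hlim : Tendsto (fun m => (L - ∫ y, lindleyFrom m y ∂ν) / ε) atTop (𝓝 0) := by
    have := ((tendsto_integral_lindleyFrom hκ hneg hint).const_sub L).div_const ε
    rwa [sub_self, zero_div] at this
  have h0 : ν.real B = 0 := le_antisymm (ge_of_tendsto' hlim hbound) measureReal_nonneg
  exact (measureReal_eq_zero_iff).1 h0

/-- The averages of Lindley's recursion started at `0` converge to the mean of the stationary
version. -/
lemma ae_tendsto_average_lindley_coord (hκ : Integrable id κ) (hneg : ∫ x, x ∂κ < 0)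
    (hint : Integrable stationaryLindley (Measure.infinitePi fun _ : ℤ => κ)) :
    ∀ᵐ y ∂(Measure.infinitePi fun _ : ℤ => κ),
      Tendsto (fun n : ℕ => (∑ i ∈ Finset.range n, lindley (fun k => y k) i) / n) atTop
        (𝓝 (∫ y, stationaryLindley y ∂(Measure.infinitePi fun _ : ℤ => κ))) := by
  set ν : Measure (ℤ → ℝ) := Measure.infinitePi fun _ : ℤ => κ
  set L := ∫ y, stationaryLindley y ∂ν
  have hT := measurePreserving_shift (κ := κ)
  have hbdd : ∀ᵐ y ∂ν, ∀ k : ℕ, BddAbove (Set.range fun n => lindleyFrom n (shift^[k] y)) :=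
    ae_all_iff.2 fun k =>
      (hT.iterate k).quasiMeasurePreserving.ae (ae_bddAbove_lindleyFrom hκ hneg)
  have hup : ∀ᵐ y ∂ν, ∀ j : ℕ, ∀ᶠ n : ℕ in atTop,
      birkhoffSum shift stationaryLindley n y / n ≤ L + 2 * (1 / ((j : ℝ) + 1)) :=
    ae_all_iff.2 fun j =>
      ae_eventually_birkhoffSum_stationaryLindley_le hκ hneg hint (by positivity)
  filter_upwards [hbdd, hup, ae_all_iff.2 (ae_tendsto_birkhoffSum_lindleyFrom hκ hneg hint)]
    with y hb hu hl
  refine tendsto_order.2 ⟨fun c hc => ?_, fun c hc => ?_⟩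
  -- below: from time `m` on, the recursion is at least the one started `m` steps back
  · obtain ⟨m, hm⟩ := ((tendsto_integral_lindleyFrom hκ hneg hint).eventually_const_lt hc).exists
    have h1 : Tendsto (fun n : ℕ => (birkhoffSum shift (lindleyFrom m) n y
        - birkhoffSum shift (lindleyFrom m) m y) / n) atTop (𝓝 (∫ y, lindleyFrom m y ∂ν)) := by
      have := (hl m).sub (tendsto_const_div_atTop_nhds_zero_nat
        (birkhoffSum shift (lindleyFrom m) m y))
      rw [sub_zero] at this
      exact this.congr fun n => by rw [sub_div]
    filter_upwards [h1.eventually_const_lt hm, eventually_ge_atTop m] with n hn hmn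
    refine hn.trans_le ?_
    gcongr
    obtain ⟨d, rfl⟩ := Nat.exists_eq_add_of_le hmn
    simp only [birkhoffSum, Finset.sum_range_add]
    have h2 : 0 ≤ ∑ i ∈ Finset.range m, lindley (fun k => y k) i :=
      Finset.sum_nonneg fun i _ => lindley_nonneg _ i
    have h3 : ∑ k ∈ Finset.range d, lindleyFrom m (shift^[m + k] y) ≤
        ∑ k ∈ Finset.range d, lindley (fun k => y k) (m + k) := by
      refine Finset.sum_le_sum fun k _ => ?_
      rw [← lindleyFrom_iterate_shift]
      exact lindleyFrom_mono _ (Nat.le_add_right m k)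
    linarith
  -- above: the recursion is at most the stationary version
  · obtain ⟨j, hj⟩ := exists_nat_one_div_lt (show 0 < (c - L) / 2 by linarith)
    filter_upwards [hu j] with n hn
    refine lt_of_le_of_lt (le_trans ?_ hn) (by linarith)
    gcongr
    refine Finset.sum_le_sum fun k _ => ?_
    rw [← lindleyFrom_iterate_shift]
    exact le_ciSup (hb k) k

end Average

/-! ### Lindley's recursion driven by independent variables -/

section Driven

variable {Ω : Type*} [MeasurableSpace Ω] {P : Measure Ω}
  {κ : Measure ℝ} [IsProbabilityMeasure κ] {U : ℕ → Ω → ℝ}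

lemma map_sequence_eq_map_coord (hU : ∀ n, Measurable (U n)) (hind : iIndepFun U P)
    (hlaw : ∀ n, P.map (U n) = κ) :
    P.map (fun ω n => U n ω) =
      (Measure.infinitePi fun _ : ℤ => κ).map (fun y (n : ℕ) => y (n : ℤ)) := by
  rw [hind.map_fun_eq_infinitePi_map hU,
    Measure.map_infinitePi_infinitePi_of_inj (P := fun _ : ℤ => κ)
      (f := fun n : ℕ => (n : ℤ)) Nat.cast_injective]
  simp_rw [hlaw]

/-- The waiting time of a customer has the law of `lindleyFrom`, by stationarity. -/
lemma map_lindley_eq_map_lindleyFrom (hU : ∀ n, Measurable (U n)) (hind : iIndepFun U P)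
    (hlaw : ∀ n, P.map (U n) = κ) (n : ℕ) :
    P.map (fun ω => lindley (fun k => U k ω) n) =
      (Measure.infinitePi fun _ : ℤ => κ).map (lindleyFrom n) := by
  have hm : Measurable fun u : ℕ → ℝ => lindley u n :=
    measurable_lindley (fun k => measurable_pi_apply k) n
  have h1 : P.map (fun ω => lindley (fun k => U k ω) n) =
      (P.map fun ω n => U n ω).map fun u => lindley u n := by
    rw [Measure.map_map hm (measurable_pi_lambda _ hU)]; rfl
  have hT := (measurePreserving_shift (κ := κ)).iterate n
  rw [h1, map_sequence_eq_map_coord hU hind hlaw, Measure.map_map hm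
    (measurable_pi_lambda _ fun _ => measurable_pi_apply _)]
  conv_rhs => rw [← hT.map_eq, Measure.map_map (measurable_lindleyFrom n) hT.measurable]
  congr 1
  ext y
  exact (lindleyFrom_iterate_shift n y).symm

lemma ae_tendsto_average_lindley (hU : ∀ n, Measurable (U n)) (hind : iIndepFun U P)
    (hlaw : ∀ n, P.map (U n) = κ) (hκ : Integrable id κ) (hneg : ∫ x, x ∂κ < 0)
    (hint : Integrable stationaryLindley (Measure.infinitePi fun _ : ℤ => κ)) :
    ∀ᵐ ω ∂P,
      Tendsto (fun n : ℕ => (∑ i ∈ Finset.range n, lindley (fun k => U k ω) i) / n) atTop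
        (𝓝 (∫ y, stationaryLindley y ∂(Measure.infinitePi fun _ : ℤ => κ))) := by
  set L := ∫ y, stationaryLindley y ∂(Measure.infinitePi fun _ : ℤ => κ)
  have hm : MeasurableSet {u : ℕ → ℝ |
      Tendsto (fun n : ℕ => (∑ i ∈ Finset.range n, lindley u i) / n) atTop (𝓝 L)} :=
    measurableSet_tendsto _ fun n => (Finset.measurable_sum _ fun i _ =>
      measurable_lindley (fun k => measurable_pi_apply k) i).div_const _
  have hrestr : Measurable fun (y : ℤ → ℝ) (n : ℕ) => y (n : ℤ) :=
    measurable_pi_lambda _ fun _ => measurable_pi_apply _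
  have h := (ae_map_iff hrestr.aemeasurable hm).2 (ae_tendsto_average_lindley_coord hκ hneg hint)
  rw [← map_sequence_eq_map_coord hU hind hlaw] at h
  exact ae_of_ae_map (measurable_pi_lambda _ hU).aemeasurable h

end Driven

/-! ### Integrals against the exponential and Poisson weights -/

/-- The Poisson weight `exp (-r) * r ^ k / k!` as a function of a real parameter. -/
noncomputable def poissonWeight (k : ℕ) (r : ℝ) : ℝ := Real.exp (-r) * r ^ k / k.factorial

lemma poissonWeight_nonneg (k : ℕ) {r : ℝ} (hr : 0 ≤ r) : 0 ≤ poissonWeight k r := by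
  unfold poissonWeight; positivity

lemma continuous_poissonWeight (k : ℕ) : Continuous (poissonWeight k) := by
  unfold poissonWeight; fun_prop

lemma poissonWeight_zero (r : ℝ) : poissonWeight 0 r = Real.exp (-r) := by simp [poissonWeight]

lemma hasSum_poissonWeight {r : ℝ} (hr : 0 ≤ r) : HasSum (fun k => poissonWeight k r) 1 :=
  hasSum_one_poissonMeasure ⟨r, hr⟩

lemma poissonWeight_le_one (k : ℕ) {r : ℝ} (hr : 0 ≤ r) : poissonWeight k r ≤ 1 :=
  le_hasSum (hasSum_poissonWeight hr) k fun j _ => poissonWeight_nonneg j hr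

lemma norm_poissonWeight_mul_le_one {lam : ℝ} (hlam : 0 < lam) (k : ℕ) (v : ℝ)
    (hv : 0 ≤ v) : ‖poissonWeight k (lam * v)‖ ≤ 1 := by
  rw [Real.norm_of_nonneg (poissonWeight_nonneg k (by positivity))]
  exact poissonWeight_le_one k (by positivity)

lemma continuous_poissonWeight_mul (lam : ℝ) (k : ℕ) :
    Continuous fun v => poissonWeight k (lam * v) :=
  (continuous_poissonWeight k).comp (continuous_const_mul lam)

/-- The mean of the Poisson distribution. -/
lemma hasSum_mul_poissonWeight {r : ℝ} (hr : 0 ≤ r) :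
    HasSum (fun k : ℕ => (k : ℝ) * poissonWeight k r) r := by
  rw [← hasSum_nat_add_iff' 1]
  have h := (hasSum_poissonWeight hr).mul_left r
  simp only [Finset.range_one, Finset.sum_singleton, Nat.cast_zero, zero_mul, sub_zero]
  rw [mul_one] at h
  refine h.congr_fun fun k => ?_
  simp only [poissonWeight, Nat.factorial_succ]
  push_cast
  field_simp
  ring

/-- The sum of independent Poisson variables is Poisson. -/
lemma poissonWeight_add (j : ℕ) (a b : ℝ) : poissonWeight j (a + b) =
    ∑ i ∈ Finset.HasAntidiagonal.antidiagonal j, poissonWeight i.1 a * poissonWeight i.2 b := by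
  rw [poissonWeight, (Commute.all a b).add_pow', Finset.mul_sum, Finset.sum_div]
  refine Finset.sum_congr rfl fun i hi => ?_
  obtain rfl := Finset.HasAntidiagonal.mem_antidiagonal.1 hi
  have h : ((i.1 + i.2).choose i.1 : ℝ) * i.1.factorial * i.2.factorial =
      (i.1 + i.2).factorial := by
    rw [Nat.choose_symm_add]
    exact_mod_cast Nat.add_choose_mul_factorial_mul_factorial i.1 i.2
  rw [nsmul_eq_mul, poissonWeight, poissonWeight, neg_add, Real.exp_add, ← h]
  have h1 : ((i.1 + i.2).choose i.1 : ℝ) ≠ 0 := by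
    exact_mod_cast (Nat.choose_pos (Nat.le_add_right _ _)).ne'
  field_simp

lemma integrable_poissonWeight {lam : ℝ} (hlam : 0 < lam) {α : Type*} [MeasurableSpace α]
    {m : Measure α} [IsProbabilityMeasure m] {Z : α → ℝ} (hZ : Measurable Z)
    (hZ0 : ∀ᵐ a ∂m, 0 ≤ Z a) (k : ℕ) :
    Integrable (fun a => poissonWeight k (lam * Z a)) m := by
  refine (integrable_const (1 : ℝ)).mono'
    ((continuous_poissonWeight_mul lam k).measurable.comp hZ).aestronglyMeasurable ?_
  filter_upwards [hZ0] with a ha using norm_poissonWeight_mul_le_one hlam k _ ha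

section Exponential

variable {lam : ℝ} (hlam : 0 < lam)
include hlam

lemma expMeasure_Iic {t : ℝ} (ht : 0 ≤ t) :
    expMeasure lam (Set.Iic t) = ENNReal.ofReal (1 - Real.exp (-(lam * t))) := by
  rw [expMeasure, gammaMeasure, withDensity_apply _ measurableSet_Iic]
  have := lintegral_exponentialPDF_eq_antiDeriv hlam t
  rwa [if_pos ht] at this

lemma expMeasure_real_Ioi {t : ℝ} (ht : 0 ≤ t) :
    (expMeasure lam).real (Set.Ioi t) = Real.exp (-(lam * t)) := by
  have := isProbabilityMeasure_expMeasure hlam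
  rw [← Set.compl_Iic, probReal_compl_eq_one_sub measurableSet_Iic, measureReal_def,
    expMeasure_Iic hlam ht, ENNReal.toReal_ofReal]
  · ring
  · rw [sub_nonneg, Real.exp_le_one_iff]
    nlinarith

lemma ae_expMeasure_pos : ∀ᵐ x ∂(expMeasure lam), 0 < x := by
  have h : expMeasure lam (Set.Iic 0) = 0 := by
    rw [expMeasure_Iic hlam le_rfl]; simp
  rw [ae_iff]
  simp only [not_lt]
  exact h

lemma setIntegral_expMeasure {w t : ℝ} (hw : 0 ≤ w) (hwt : w ≤ t) (f : ℝ → ℝ) :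
    ∫ x in Set.Ioc w t, f x ∂(expMeasure lam) =
      ∫ x in w..t, lam * Real.exp (-(lam * x)) * f x := by
  rw [intervalIntegral.integral_of_le hwt, expMeasure, gammaMeasure,
    setIntegral_withDensity_eq_setIntegral_toReal_smul _ _ _ measurableSet_Ioc]
  · refine setIntegral_congr_fun measurableSet_Ioc fun x hx => ?_
    have hx0 : 0 ≤ x := hw.trans hx.1.le
    change (exponentialPDF lam x).toReal • f x = _
    rw [exponentialPDF_of_nonneg hx0, ENNReal.toReal_ofReal (by positivity), smul_eq_mul]
  · exact (measurable_gammaPDFReal 1 lam).ennreal_ofReal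
  · exact Eventually.of_forall fun x => ENNReal.ofReal_lt_top

/-- The first arrival happens in `(w, t]`, and `k` further arrivals happen by time `t`. -/
lemma setIntegral_expMeasure_poissonWeight {w t : ℝ} (hw : 0 ≤ w) (hwt : w ≤ t) (k : ℕ) :
    ∫ x in Set.Ioc w t, poissonWeight k (lam * (t - x)) ∂(expMeasure lam) =
      Real.exp (-(lam * w)) * poissonWeight (k + 1) (lam * (t - w)) := by
  rw [setIntegral_expMeasure hlam hw hwt]
  have hderiv : ∀ x ∈ Set.uIcc w t, HasDerivAt
      (fun x => -(Real.exp (-(lam * t)) * (lam * (t - x)) ^ (k + 1) / (k + 1).factorial))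
      (lam * Real.exp (-(lam * x)) * poissonWeight k (lam * (t - x))) x := by
    intro x _
    have h1 : HasDerivAt (fun x : ℝ => lam * (t - x)) (lam * (-1)) x :=
      ((hasDerivAt_id x).const_sub t).const_mul lam
    have h2 := (((h1.pow (k + 1)).const_mul (Real.exp (-(lam * t)))).div_const
      ((k + 1).factorial : ℝ)).neg
    refine h2.congr_deriv ?_
    have h3 : Real.exp (-(lam * t)) = Real.exp (-(lam * x)) * Real.exp (-(lam * (t - x))) := by
      rw [← Real.exp_add]; congr 1; ring
    rw [h3, poissonWeight, Nat.factorial_succ]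
    push_cast
    field_simp
  rw [intervalIntegral.integral_eq_sub_of_hasDerivAt hderiv]
  · have h3 : Real.exp (-(lam * t)) = Real.exp (-(lam * w)) * Real.exp (-(lam * (t - w))) := by
      rw [← Real.exp_add]; congr 1; ring
    rw [h3, poissonWeight]
    simp
    ring
  · refine Continuous.intervalIntegrable ?_ _ _
    have := continuous_poissonWeight k
    fun_prop

lemma integral_expMeasure_max {v : ℝ} (hv : 0 ≤ v) {f : ℝ → ℝ} (hf : Continuous f) :
    ∫ x, f (max 0 (v - x)) ∂(expMeasure lam) =
      ∫ x in Set.Ioc 0 v, f (v - x) ∂(expMeasure lam) + Real.exp (-(lam * v)) * f 0 := by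
  have := isProbabilityMeasure_expMeasure hlam
  obtain ⟨C, hC⟩ := (isCompact_Icc (a := (0 : ℝ)) (b := v)).exists_bound_of_continuousOn
    hf.continuousOn
  have hint : Integrable (fun x => f (max 0 (v - x))) (expMeasure lam) := by
    refine (integrable_const C).mono' (by fun_prop) ?_
    filter_upwards [ae_expMeasure_pos hlam] with x hx
    exact hC _ ⟨le_max_left _ _, max_le hv (by linarith)⟩
  rw [← integral_add_compl measurableSet_Iic hint, Set.compl_Iic]
  congr 1
  · have h0 : (Set.Iic v : Set ℝ) =ᵐ[expMeasure lam] Set.Ioc 0 v := by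
      filter_upwards [ae_expMeasure_pos hlam] with x hx
      exact propext ⟨fun h => ⟨hx, h⟩, fun h => h.2⟩
    rw [setIntegral_congr_set h0]
    refine setIntegral_congr_fun measurableSet_Ioc fun x hx => ?_
    simp only [max_eq_right (sub_nonneg.2 hx.2)]
  · rw [← expMeasure_real_Ioi hlam hv, ← smul_eq_mul, ← setIntegral_const]
    refine setIntegral_congr_fun measurableSet_Ioi fun x hx => ?_
    have hx' : v - x ≤ 0 := sub_nonpos.2 (le_of_lt (Set.mem_Ioi.1 hx))
    simp only [max_eq_left hx']

/-- The number of Poisson arrivals during `(v - x)⁺`, where `x` is the time of the first arrival,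
is the number of arrivals during `v`, less one if there are any. -/
lemma integral_poissonWeight_max {v : ℝ} (hv : 0 ≤ v) (i : ℕ) :
    ∫ x, poissonWeight i (lam * max 0 (v - x)) ∂(expMeasure lam) =
      poissonWeight (i + 1) (lam * v) + if i = 0 then poissonWeight 0 (lam * v) else 0 := by
  have h := integral_expMeasure_max hlam hv (f := fun y => poissonWeight i (lam * y))
    ((continuous_poissonWeight i).comp (by fun_prop))
  rw [h, setIntegral_expMeasure_poissonWeight hlam le_rfl hv]
  rcases i with _ | i
  · simp [poissonWeight]
  · simp [poissonWeight]

/-- The Laplace transform of `(v - x)⁺` for an exponential `x`, multiplied by `lam - θ` in order to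
cover the case `θ = lam`. -/
lemma integral_exp_max {v : ℝ} (hv : 0 ≤ v) (θ : ℝ) :
    (lam - θ) * ∫ x, Real.exp (-(θ * max 0 (v - x))) ∂(expMeasure lam) =
      lam * Real.exp (-(θ * v)) - θ * Real.exp (-(lam * v)) := by
  rw [integral_expMeasure_max hlam hv (f := fun y => Real.exp (-(θ * y))) (by fun_prop),
    setIntegral_expMeasure hlam le_rfl hv, mul_add, ← intervalIntegral.integral_const_mul]
  have hderiv : ∀ x ∈ Set.uIcc 0 v, HasDerivAt
      (fun x => -(lam * Real.exp (-(lam * x) - θ * (v - x))))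
      ((lam - θ) * (lam * Real.exp (-(lam * x)) * Real.exp (-(θ * (v - x))))) x := by
    intro x _
    have h1 : HasDerivAt (fun x : ℝ => -(lam * x) - θ * (v - x)) (-(lam * 1) - θ * (-1)) x :=
      ((hasDerivAt_id x).const_mul lam).neg.sub (((hasDerivAt_id x).const_sub v).const_mul θ)
    refine ((h1.exp.const_mul lam).neg).congr_deriv ?_
    rw [sub_eq_add_neg, Real.exp_add]
    ring
  rw [intervalIntegral.integral_eq_sub_of_hasDerivAt hderiv
    (Continuous.intervalIntegrable (by fun_prop) _ _)]
  simp
  ring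

end Exponential

/-! ### The Poisson process -/

section PoissonProcess

lemma measurable_arrivalTime (m : ℕ) : Measurable fun x : ℕ → ℝ => arrivalTime x m :=
  Finset.measurable_sum _ fun k _ => measurable_pi_apply k

lemma measurableSet_countIs {α : Type*} [MeasurableSpace α] {y : α → ℕ → ℝ} {t : α → ℝ}
    (hy : Measurable y) (ht : Measurable t) (k : ℕ) :
    MeasurableSet {a | CountIs (y a) (t a) k} := by
  have : {a | CountIs (y a) (t a) k} = ⋂ m, {a | arrivalTime (y a) m ≤ t a ↔ m < k} := by
    ext a; simp [CountIs]
  rw [this]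
  refine MeasurableSet.iInter fun m => ?_
  have h1 := measurableSet_le ((measurable_arrivalTime m).comp hy) ht
  by_cases hm : m < k
  · simpa [hm] using h1
  · have h2 : {a | arrivalTime (y a) m ≤ t a ↔ m < k} = {a | arrivalTime (y a) m ≤ t a}ᶜ := by
      ext a; simp [hm]
    rw [h2]
    exact h1.compl

lemma measureReal_prod_apply' {α β : Type*} [MeasurableSpace α] [MeasurableSpace β]
    (μ : Measure α) (ν : Measure β) [IsProbabilityMeasure μ] [IsProbabilityMeasure ν]
    {s : Set (α × β)} (hs : MeasurableSet s) :
    (μ.prod ν).real s = ∫ x, ν.real (Prod.mk x ⁻¹' s) ∂μ := by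
  rw [measureReal_def, Measure.prod_apply hs]
  exact (integral_toReal (measurable_measure_prodMk_left hs).aemeasurable
    (Eventually.of_forall fun _ => measure_lt_top _ _)).symm

/-- The first term of a sequence of independent variables is independent of the others, which
again form such a sequence. -/
lemma map_head_tail_infinitePi (κ : Measure ℝ) [IsProbabilityMeasure κ] :
    (Measure.infinitePi fun _ : ℕ => κ).map (fun x => (x 0, fun k => x (k + 1))) =
      κ.prod (Measure.infinitePi fun _ : ℕ => κ) := by
  have hcoord : iIndepFun (fun (i : ℕ) (y : ℕ → ℝ) => y i) (Measure.infinitePi fun _ : ℕ => κ) :=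
    iIndepFun_infinitePi (P := fun _ : ℕ => κ) (X := fun _ x => x) fun _ => measurable_id
  have htail : Measurable fun (x : ℕ → ℝ) (k : ℕ) => x (k + 1) :=
    measurable_pi_lambda _ fun _ => measurable_pi_apply _
  have hind := indepFun_of_dependsOn hcoord measurable_pi_apply (F := fun x : ℕ → ℝ => x 0)
    (G := fun x k => x (k + 1)) (A := {0}) (B := {0}ᶜ) (measurable_pi_apply 0) htail
    (fun x y h => h 0 rfl) (fun x y h => funext fun k => h _ (by simp)) disjoint_compl_right
  have h := hind.map_prod_eq_prod_map_map (measurable_pi_apply 0).aemeasurable htail.aemeasurable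
  rw [h, Measure.infinitePi_map_eval (fun _ : ℕ => κ) 0,
    Measure.map_infinitePi_infinitePi_of_inj (P := fun _ : ℕ => κ) (f := fun k => k + 1)
      (add_left_injective 1)]

lemma measureReal_infinitePi_eq_integral (κ : Measure ℝ) [IsProbabilityMeasure κ]
    {B : Set (ℝ × (ℕ → ℝ))} (hB : MeasurableSet B) :
    (Measure.infinitePi fun _ : ℕ => κ).real {x | (x 0, fun k => x (k + 1)) ∈ B} =
      ∫ a, (Measure.infinitePi fun _ : ℕ => κ).real {y | (a, y) ∈ B} ∂κ := by
  refine Eq.trans ?_ (measureReal_prod_apply' _ _ hB)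
  rw [← map_head_tail_infinitePi, map_measureReal_apply _ hB]
  · rfl
  · exact (measurable_pi_apply 0).prodMk (measurable_pi_lambda _ fun _ => measurable_pi_apply _)

/-- Conditioning on the first arrival, on which the recursions for the laws of the counts rest. -/
lemma countIs_succ {x : ℕ → ℝ} {t : ℝ} {k : ℕ} :
    CountIs x t (k + 1) ↔ x 0 ≤ t ∧ CountIs (fun k => x (k + 1)) (t - x 0) k := by
  refine ⟨fun h => ⟨by simpa [arrivalTime] using h 0, fun m => ?_⟩, fun h m => ?_⟩
  · have := h (m + 1)
    rw [arrivalTime_succ', ← le_sub_iff_add_le', Nat.add_lt_add_iff_right] at this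
    exact this
  · rcases m with _ | m
    · simpa [arrivalTime] using h.1
    · rw [arrivalTime_succ', ← le_sub_iff_add_le', Nat.add_lt_add_iff_right]
      exact h.2 m

lemma countIs_zero {x : ℕ → ℝ} (hx : ∀ k, 0 < x k) {t : ℝ} : CountIs x t 0 ↔ t < x 0 := by
  refine ⟨fun h => not_le.1 fun hc => lt_irrefl 0 ((h 0).1 (by simpa [arrivalTime] using hc)),
    fun h m => ⟨fun hm => ?_, fun hm => absurd hm (Nat.not_lt_zero m)⟩⟩
  have h1 := (arrivalTime_strictMono hx).monotone (Nat.zero_le m)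
  have h2 : arrivalTime x 0 = x 0 := by simp [arrivalTime]
  linarith

variable {lam : ℝ} (hlam : 0 < lam)
include hlam

lemma ae_infinitePi_expMeasure_pos :
    ∀ᵐ x ∂(Measure.infinitePi fun _ : ℕ => expMeasure lam), ∀ k, 0 < x k := by
  have := isProbabilityMeasure_expMeasure hlam
  refine ae_all_iff.2 fun k => ?_
  have hk := measurePreserving_eval_infinitePi (fun _ : ℕ => expMeasure lam) k
  exact hk.quasiMeasurePreserving.ae (ae_expMeasure_pos hlam)

lemma setIntegral_Iic_expMeasure {w : ℝ} (f : ℝ → ℝ) :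
    ∫ x in Set.Iic w, f x ∂(expMeasure lam) = ∫ x in Set.Ioc 0 w, f x ∂(expMeasure lam) := by
  refine setIntegral_congr_set ?_
  filter_upwards [ae_expMeasure_pos hlam] with x hx
  exact propext ⟨fun h => ⟨hx, h⟩, fun h => h.2⟩

/-- The number of arrivals of a Poisson process by time `t` has a Poisson distribution. -/
lemma measureReal_countIs {t : ℝ} (ht : 0 ≤ t) (k : ℕ) :
    (Measure.infinitePi fun _ : ℕ => expMeasure lam).real {x | CountIs x t k} =
      poissonWeight k (lam * t) := by
  have := isProbabilityMeasure_expMeasure hlam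
  set ν : Measure (ℕ → ℝ) := Measure.infinitePi fun _ : ℕ => expMeasure lam
  induction k generalizing t with
  | zero =>
    have h1 : ν.real {x | CountIs x t 0} = ν.real ((fun x : ℕ → ℝ => x 0) ⁻¹' Set.Ioi t) := by
      refine measureReal_congr ?_
      filter_upwards [ae_infinitePi_expMeasure_pos hlam] with x hx
      exact propext (countIs_zero hx)
    rw [h1, ← map_measureReal_apply (measurable_pi_apply 0) measurableSet_Ioi,
      Measure.infinitePi_map_eval (fun _ : ℕ => expMeasure lam) 0, expMeasure_real_Ioi hlam ht,
      poissonWeight_zero]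
  | succ k ih =>
    have hB : MeasurableSet {p : ℝ × (ℕ → ℝ) | p.1 ≤ t ∧ CountIs p.2 (t - p.1) k} :=
      (measurableSet_le measurable_fst measurable_const).inter
        (measurableSet_countIs measurable_snd (measurable_const.sub measurable_fst) k)
    have h1 := measureReal_infinitePi_eq_integral (expMeasure lam) hB
    simp only [Set.mem_ofPred_eq, ← countIs_succ] at h1
    have h2 : ∀ a, ν.real {y | a ≤ t ∧ CountIs y (t - a) k} =
        (Set.Iic t).indicator (fun a => poissonWeight k (lam * (t - a))) a := by
      intro a
      by_cases ha : a ≤ t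
      · simp [ha, ih (sub_nonneg.2 ha)]
      · simp [ha]
    simp only [ν] at h2 ⊢
    rw [h1]
    simp_rw [h2]
    rw [integral_indicator measurableSet_Iic, setIntegral_Iic_expMeasure hlam,
      setIntegral_expMeasure_poissonWeight hlam le_rfl ht]
    simp

/-- The numbers of arrivals of a Poisson process by time `w` and during the following time `s` are
independent and have Poisson distributions. -/
lemma measureReal_countIs_and_countIs {w s : ℝ} (hw : 0 ≤ w) (hs : 0 ≤ s) (j k : ℕ) :
    (Measure.infinitePi fun _ : ℕ => expMeasure lam).real
      {x | CountIs x w j ∧ CountIs x (w + s) (j + k)} =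
      poissonWeight j (lam * w) * poissonWeight k (lam * s) := by
  have := isProbabilityMeasure_expMeasure hlam
  set ν : Measure (ℕ → ℝ) := Measure.infinitePi fun _ : ℕ => expMeasure lam
  induction j generalizing w with
  | zero =>
    rcases k with _ | k
    · have h1 : {x | CountIs x w 0 ∧ CountIs x (w + s) (0 + 0)} = {x | CountIs x (w + s) 0} := by
        ext x
        exact ⟨fun h => h.2, fun h => ⟨fun m => ⟨fun hm => (h m).1 (by linarith),
          fun hm => absurd hm (Nat.not_lt_zero m)⟩, h⟩⟩
      rw [h1, measureReal_countIs hlam (add_nonneg hw hs)]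
      simp only [poissonWeight_zero, ← Real.exp_add]
      congr 1; ring
    · have hB : MeasurableSet {p : ℝ × (ℕ → ℝ) | (w < p.1 ∧ p.1 ≤ w + s) ∧
          CountIs p.2 (w + s - p.1) k} :=
        ((measurableSet_lt measurable_const measurable_fst).inter
          (measurableSet_le measurable_fst measurable_const)).inter
          (measurableSet_countIs measurable_snd (measurable_const.sub measurable_fst) k)
      have h1 := measureReal_infinitePi_eq_integral (expMeasure lam) hB
      simp only [Set.mem_ofPred_eq] at h1
      have h0 : ν.real {x | CountIs x w 0 ∧ CountIs x (w + s) (0 + (k + 1))} =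
          ν.real {x | (w < x 0 ∧ x 0 ≤ w + s) ∧ CountIs (fun k => x (k + 1)) (w + s - x 0) k} := by
        refine measureReal_congr ?_
        filter_upwards [ae_infinitePi_expMeasure_pos hlam] with x hx
        refine propext ?_
        change (CountIs x w 0 ∧ CountIs x (w + s) (0 + (k + 1))) ↔ ((w < x 0 ∧ x 0 ≤ w + s) ∧ _)
        rw [zero_add, countIs_succ, countIs_zero hx, and_assoc]
      have h2 : ∀ a, ν.real {y | (w < a ∧ a ≤ w + s) ∧ CountIs y (w + s - a) k} =
          (Set.Ioc w (w + s)).indicator (fun a => poissonWeight k (lam * (w + s - a))) a := by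
        intro a
        by_cases ha : w < a ∧ a ≤ w + s
        · simp [ha, measureReal_countIs hlam (sub_nonneg.2 ha.2), ν]
        · have : a ∉ Set.Ioc w (w + s) := ha
          rw [Set.indicator_of_notMem this]
          simp [ha]
      simp only [ν] at h0 h2 ⊢
      rw [h0, h1]
      simp_rw [h2]
      rw [integral_indicator measurableSet_Ioc,
        setIntegral_expMeasure_poissonWeight hlam hw (by linarith), add_sub_cancel_left,
        poissonWeight_zero]
  | succ j ih =>
    have hB : MeasurableSet {p : ℝ × (ℕ → ℝ) | p.1 ≤ w ∧ CountIs p.2 (w - p.1) j ∧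
        CountIs p.2 (w - p.1 + s) (j + k)} :=
      (measurableSet_le measurable_fst measurable_const).inter
        ((measurableSet_countIs measurable_snd (measurable_const.sub measurable_fst) j).inter
        (measurableSet_countIs measurable_snd
          ((measurable_const.sub measurable_fst).add measurable_const) (j + k)))
    have h1 := measureReal_infinitePi_eq_integral (expMeasure lam) hB
    simp only [Set.mem_ofPred_eq] at h1
    have h0 : {x | CountIs x w (j + 1) ∧ CountIs x (w + s) (j + 1 + k)} =
        {x | x 0 ≤ w ∧ CountIs (fun k => x (k + 1)) (w - x 0) j ∧
          CountIs (fun k => x (k + 1)) (w - x 0 + s) (j + k)} := by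
      ext x
      simp only [Set.mem_ofPred_eq]
      rw [add_right_comm j 1 k, countIs_succ, countIs_succ, sub_add_eq_add_sub]
      exact ⟨fun h => ⟨h.1.1, h.1.2, h.2.2⟩, fun h => ⟨⟨h.1, h.2.1⟩, by linarith [h.1], h.2.2⟩⟩
    have h2 : ∀ a, ν.real {y | a ≤ w ∧ CountIs y (w - a) j ∧ CountIs y (w - a + s) (j + k)} =
        (Set.Iic w).indicator (fun a => poissonWeight j (lam * (w - a))) a *
          poissonWeight k (lam * s) := by
      intro a
      by_cases ha : a ≤ w
      · simp [ha, ih (sub_nonneg.2 ha)]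
      · simp [ha]
    simp only [ν] at h2 ⊢
    rw [h0, h1]
    simp_rw [h2]
    rw [integral_mul_const, integral_indicator measurableSet_Iic, setIntegral_Iic_expMeasure hlam,
      setIntegral_expMeasure_poissonWeight hlam le_rfl hw]
    simp

/-- The increments of a Poisson process are stationary: the number of arrivals during the time `s`
after time `w` has a Poisson distribution that does not depend on `w`. -/
lemma measureReal_exists_countIs {w s : ℝ} (hw : 0 ≤ w) (hs : 0 ≤ s) (k : ℕ) :
    (Measure.infinitePi fun _ : ℕ => expMeasure lam).real
      {x | ∃ j, CountIs x w j ∧ CountIs x (w + s) (j + k)} = poissonWeight k (lam * s) := by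
  have := isProbabilityMeasure_expMeasure hlam
  set ν : Measure (ℕ → ℝ) := Measure.infinitePi fun _ : ℕ => expMeasure lam
  have hU : {x : ℕ → ℝ | ∃ j, CountIs x w j ∧ CountIs x (w + s) (j + k)} =
      ⋃ j, {x | CountIs x w j ∧ CountIs x (w + s) (j + k)} := by
    ext x; simp
  have hmeas : ∀ j, MeasurableSet {x : ℕ → ℝ | CountIs x w j ∧ CountIs x (w + s) (j + k)} :=
    fun j => (measurableSet_countIs measurable_id measurable_const j).inter
      (measurableSet_countIs measurable_id measurable_const (j + k))
  have hdisj : Pairwise (Function.onFun Disjoint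
      fun j => {x : ℕ → ℝ | CountIs x w j ∧ CountIs x (w + s) (j + k)}) := by
    intro i j hij
    rw [Function.onFun, Set.disjoint_left]
    intro x hi hj
    exact hij (hi.1.unique hj.1)
  have hsum := (hasSum_poissonWeight (show 0 ≤ lam * w by positivity)).mul_right
    (poissonWeight k (lam * s))
  rw [one_mul] at hsum
  have hterm : ∀ j, ν {x | CountIs x w j ∧ CountIs x (w + s) (j + k)} =
      ENNReal.ofReal (poissonWeight j (lam * w) * poissonWeight k (lam * s)) := fun j => by
    rw [← measureReal_countIs_and_countIs hlam hw hs, ofReal_measureReal]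
  have hnn : ∀ j, 0 ≤ poissonWeight j (lam * w) * poissonWeight k (lam * s) := fun j =>
    mul_nonneg (poissonWeight_nonneg _ (by positivity)) (poissonWeight_nonneg _ (by positivity))
  rw [hU, measureReal_def, measure_iUnion hdisj hmeas]
  simp_rw [hterm]
  rw [← ENNReal.ofReal_tsum_of_nonneg hnn hsum.summable, hsum.tsum_eq,
    ENNReal.toReal_ofReal (poissonWeight_nonneg _ (by positivity))]

end PoissonProcess

/-! ### The mean of the exponential distribution -/

lemma lintegral_expMeasure_id {lam : ℝ} (hlam : 0 < lam) :
    ∫⁻ x, ENNReal.ofReal x ∂(expMeasure lam) = ENNReal.ofReal (1 / lam) := by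
  have hpdf : ∀ x : ℝ, exponentialPDF lam x * ENNReal.ofReal x =
      ENNReal.ofReal (1 / lam) * gammaPDF 2 lam x := by
    intro x
    rcases le_or_gt 0 x with hx | hx
    · rw [exponentialPDF_of_nonneg hx, gammaPDF_of_nonneg hx, ← ENNReal.ofReal_mul (by positivity),
        ← ENNReal.ofReal_mul (by positivity)]
      congr 1
      have h1 : (2 : ℝ) - 1 = 1 := by norm_num
      rw [h1, Real.rpow_one, Real.Gamma_two, Real.rpow_two]
      field_simp
    · rw [exponentialPDF_of_neg hx, gammaPDF_of_neg hx, zero_mul, mul_zero]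
  have hm : Measurable (gammaPDF 1 lam) := (measurable_gammaPDFReal 1 lam).ennreal_ofReal
  rw [expMeasure, gammaMeasure, lintegral_withDensity_eq_lintegral_mul _ hm
    ENNReal.measurable_ofReal]
  change ∫⁻ x, exponentialPDF lam x * ENNReal.ofReal x = _
  simp_rw [hpdf]
  have hm2 : Measurable (gammaPDF 2 lam) := (measurable_gammaPDFReal 2 lam).ennreal_ofReal
  rw [lintegral_const_mul _ hm2, lintegral_gammaPDF_eq_one two_pos hlam, mul_one]

lemma integrable_id_expMeasure {lam : ℝ} (hlam : 0 < lam) : Integrable id (expMeasure lam) := by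
  refine ⟨measurable_id.aestronglyMeasurable, ?_⟩
  have h0 : 0 ≤ᵐ[expMeasure lam] id := (ae_expMeasure_pos hlam).mono fun x hx => le_of_lt hx
  rw [hasFiniteIntegral_iff_ofReal h0]
  simp only [id]
  rw [lintegral_expMeasure_id hlam]
  exact ENNReal.ofReal_lt_top

lemma integral_id_expMeasure {lam : ℝ} (hlam : 0 < lam) : ∫ x, x ∂(expMeasure lam) = 1 / lam := by
  rw [integral_eq_lintegral_of_nonneg_ae ((ae_expMeasure_pos hlam).mono fun x hx => hx.le)
    measurable_id.aestronglyMeasurable, lintegral_expMeasure_id hlam,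
    ENNReal.toReal_ofReal (by positivity)]

/-- Of two independent variables, the second may be integrated out first. -/
lemma integral_prod_of_indepFun {Ω α β : Type*} [MeasurableSpace Ω] [MeasurableSpace α]
    [MeasurableSpace β] {P : Measure Ω} [IsProbabilityMeasure P] {f : Ω → α} {g : Ω → β}
    (hf : Measurable f) (hg : Measurable g) (hfg : IndepFun f g P) {h : α → β → ℝ}
    (hh : Measurable (Function.uncurry h)) (hi : Integrable (fun ω => h (f ω) (g ω)) P) :
    ∫ ω, h (f ω) (g ω) ∂P = ∫ ω, ∫ y, h (f ω) y ∂(P.map g) ∂P := by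
  have := Measure.isProbabilityMeasure_map (μ := P) hf.aemeasurable
  have := Measure.isProbabilityMeasure_map (μ := P) hg.aemeasurable
  have hmap := hfg.map_prod_eq_prod_map_map hf.aemeasurable hg.aemeasurable
  have hi' : Integrable (Function.uncurry h) ((P.map f).prod (P.map g)) := by
    rw [← hmap]
    exact (integrable_map_measure hh.aestronglyMeasurable (hf.prodMk hg).aemeasurable).2 hi
  have h1 : ∫ ω, h (f ω) (g ω) ∂P = ∫ p, Function.uncurry h p ∂((P.map f).prod (P.map g)) := by
    rw [← hmap, integral_map (hf.prodMk hg).aemeasurable hh.aestronglyMeasurable]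
    rfl
  rw [h1, integral_prod _ hi', integral_map hf.aemeasurable]
  · rfl
  · exact hi'.integral_prod_left.aestronglyMeasurable

/-! ### The laws of the waiting times and of the counts -/

section Laws

variable {Ω : Type*} [MeasurableSpace Ω] {P : Measure Ω} {lam mu sigma : ℝ} {X S : ℕ → Ω → ℝ}

/-- The inter-arrival times (indexed by `false`) and the service times (indexed by `true`) as one
family of random variables. -/
def inputs (X S : ℕ → Ω → ℝ) (i : Bool × ℕ) (ω : Ω) : ℝ := if i.1 then S i.2 ω else X i.2 ω

/-- The waiting time of customer `n` depends only on the inputs of the earlier customers and on the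
inter-arrival times up to the arrival of customer `n`. -/
lemma dependsOn_waitingTime (n : ℕ) :
    DependsOn (fun z : Bool × ℕ → ℝ => waitingTime (fun k => z (false, k)) (fun k => z (true, k)) n)
      ({i | i.1 = false ∧ i.2 ≤ n} ∪ {i | i.1 = true ∧ i.2 < n}) :=
  fun x y hxy => lindley_congr fun k hk => by
    have h1 := hxy (true, k) (Or.inr ⟨rfl, hk⟩)
    have h2 := hxy (false, k + 1) (Or.inl ⟨rfl, hk⟩)
    simp only [h1, h2]

lemma measurable_waitingTime' (n : ℕ) :
    Measurable fun z : Bool × ℕ → ℝ =>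
      waitingTime (fun k => z (false, k)) (fun k => z (true, k)) n :=
  measurable_lindley (u := fun k (z : Bool × ℕ → ℝ) => z (true, k) - z (false, k + 1))
    (fun _ => by fun_prop) n

namespace IsMG1

variable (h : IsMG1 P lam mu sigma X S)
include h

lemma isProbabilityMeasure : IsProbabilityMeasure P := h.indep_service.isProbabilityMeasure

lemma measurable_inputs (i : Bool × ℕ) : Measurable (inputs X S i) := by
  rcases i with ⟨_ | _, n⟩
  · exact h.measurable_interarrival n
  · exact h.measurable_service n

lemma iIndepFun_inputs : iIndepFun (inputs X S) P := by
  have := h.isProbabilityMeasure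
  set Z : Bool → ℕ → Ω → ℝ := fun b n => inputs X S (b, n)
  have hind : IndepFun (fun ω n => Z false n ω) (fun ω n => Z true n ω) P :=
    h.indep_interarrival_service
  refine iIndepFun_uncurry' (X := Z) (fun b n => h.measurable_inputs (b, n)) ?_ fun b => ?_
  · rw [iIndepFun_iff_measure_inter_preimage_eq_mul]
    intro B sets hsets
    have hB : B = ∅ ∨ B = {false} ∨ B = {true} ∨ B = {false, true} := by
      clear hsets; revert B; decide
    rcases hB with rfl | rfl | rfl | rfl
    · simp
    · simp
    · simp
    · have h1 := hind.measure_inter_preimage_eq_mul (sets false) (sets true)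
        (hsets _ (by simp)) (hsets _ (by simp))
      rw [Finset.set_biInter_insert, Finset.set_biInter_singleton,
        Finset.prod_pair (by simp)]
      exact h1
  · cases b
    · exact h.indep_interarrival
    · exact h.indep_service

lemma measurable_waitingTime (n : ℕ) :
    Measurable fun ω => waitingTime (fun k => X k ω) (fun k => S k ω) n :=
  measurable_lindley (u := fun k ω => S k ω - X (k + 1) ω)
    (fun _ => (h.measurable_service _).sub (h.measurable_interarrival _)) n

lemma measurable_sojournTime (n : ℕ) :
    Measurable fun ω => sojournTime (fun k => X k ω) (fun k => S k ω) n :=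
  (h.measurable_waitingTime n).add (h.measurable_service n)

lemma indepFun_waitingTime_service (n : ℕ) :
    IndepFun (fun ω => waitingTime (fun k => X k ω) (fun k => S k ω) n) (S n) P :=
  indepFun_of_dependsOn h.iIndepFun_inputs h.measurable_inputs (measurable_waitingTime' n)
    (measurable_pi_apply (true, n)) (dependsOn_waitingTime n) (B := {(true, n)})
    (fun x y hxy => hxy _ rfl) (by simp)

/-- When the service of customer `n` starts, the arrivals after customer `n` are independent of the
past. -/
lemma indepFun_waitingTime_tail (n : ℕ) :
    IndepFun (fun ω => (waitingTime (fun k => X k ω) (fun k => S k ω) n, S n ω))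
      (fun ω m => X (n + 1 + m) ω) P := by
  refine indepFun_of_dependsOn h.iIndepFun_inputs h.measurable_inputs
    (F := fun z => (waitingTime (fun k => z (false, k)) (fun k => z (true, k)) n, z (true, n)))
    (G := fun z m => z (false, n + 1 + m))
    (A := ({i | i.1 = false ∧ i.2 ≤ n} ∪ {i | i.1 = true ∧ i.2 < n}) ∪ {(true, n)})
    (B := {i | i.1 = false ∧ n < i.2})
    ((measurable_waitingTime' n).prodMk (measurable_pi_apply _))
    (measurable_pi_lambda _ fun _ => measurable_pi_apply _)
    (fun x y hxy => Prod.ext (dependsOn_waitingTime n fun i hi => hxy i (Or.inl hi))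
      (hxy _ (Or.inr rfl)))
    (fun x y hxy => funext fun m => hxy _ ⟨rfl, by simp; omega⟩) ?_
  rw [Set.disjoint_left]
  rintro ⟨b, k⟩ ((⟨-, h1⟩ | ⟨h1, -⟩) | h1) ⟨h2, h3⟩
  · exact absurd h1 (not_le.2 h3)
  · exact absurd (h1.symm.trans h2) (by simp)
  · simp only [Set.mem_singleton_iff, Prod.mk.injEq] at h1
    exact absurd (h1.1.symm.trans h2) (by simp)

lemma indepFun_sojournTime_interarrival (n : ℕ) :
    IndepFun (fun ω => sojournTime (fun k => X k ω) (fun k => S k ω) n) (X (n + 1)) P :=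
  (h.indepFun_waitingTime_tail n).comp (φ := fun p : ℝ × ℝ => p.1 + p.2)
    (ψ := fun x : ℕ → ℝ => x 0) (by fun_prop) (by fun_prop)

lemma map_tail (n : ℕ) : P.map (fun ω m => X (n + 1 + m) ω) =
    Measure.infinitePi fun _ : ℕ => expMeasure lam := by
  rw [iIndepFun.map_fun_eq_infinitePi_map (fun m => h.measurable_interarrival (n + 1 + m))
    (h.indep_interarrival.precomp (g := fun m => n + 1 + m) (add_right_injective _))]
  simp_rw [h.law_interarrival]

lemma map_service (n : ℕ) : P.map (S n) = P.map (S 0) := (h.identDistrib_service n).map_eq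

lemma iIndepFun_service_sub_interarrival : iIndepFun (fun n ω => S n ω - X (n + 1) ω) P := by
  refine iIndepFun_of_dependsOn h.iIndepFun_inputs h.measurable_inputs
    (F := fun n z => z (true, n) - z (false, n + 1)) (A := fun n => {(true, n), (false, n + 1)})
    (fun n => (measurable_pi_apply _).sub (measurable_pi_apply _))
    (fun n x y hxy => by simp [hxy (true, n) (by simp), hxy (false, n + 1) (by simp)]) ?_
  intro m n hmn
  simp [Function.onFun, hmn.symm]

lemma map_service_sub_interarrival (n : ℕ) :
    P.map (fun ω => S n ω - X (n + 1) ω) = P.map (fun ω => S 0 ω - X 1 ω) := by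
  have hlaw : ∀ n, P.map (fun ω => S n ω - X (n + 1) ω) =
      ((P.map (S 0)).prod (expMeasure lam)).map (fun p => p.1 - p.2) := fun n => by
    have := h.isProbabilityMeasure
    have hi : IndepFun (S n) (X (n + 1)) P :=
      h.iIndepFun_inputs.indepFun (i := (true, n)) (j := (false, n + 1)) (by simp)
    have h1 := hi.map_prod_eq_prod_map_map (h.measurable_service n).aemeasurable
      (h.measurable_interarrival (n + 1)).aemeasurable
    rw [h.map_service, h.law_interarrival] at h1
    have hsub : Measurable fun p : ℝ × ℝ => p.1 - p.2 := by fun_prop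
    rw [← h1, Measure.map_map hsub
      ((h.measurable_service n).prodMk (h.measurable_interarrival (n + 1)))]
    rfl
  rw [hlaw n, ← hlaw 0]

lemma ae_service_nonneg : ∀ᵐ ω ∂P, ∀ n, 0 ≤ S n ω := ae_all_iff.2 h.service_nonneg

lemma integrable_service : Integrable (S 0) P :=
  have := h.isProbabilityMeasure
  h.memLp_service.integrable one_le_two

lemma identDistrib_interarrival (n : ℕ) : IdentDistrib (X n) id P (expMeasure lam) :=
  ⟨(h.measurable_interarrival n).aemeasurable, aemeasurable_id, by
    rw [Measure.map_id]; exact h.law_interarrival n⟩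

lemma ae_tendsto_average_service :
    ∀ᵐ ω ∂P, Tendsto (fun n : ℕ => (∑ i ∈ Finset.range n, S i ω) / n) atTop (𝓝 (1 / mu)) := by
  rw [← h.mean_service]
  exact strong_law_ae_real S h.integrable_service (fun i j hij => h.indep_service.indepFun hij)
    h.identDistrib_service

variable (hlam : 0 < lam)
include hlam

lemma ae_tendsto_arrivalTime_div : ∀ᵐ ω ∂P, Tendsto
    (fun n : ℕ => arrivalTime (fun k => X k ω) n / n) atTop (𝓝 (1 / lam)) := by
  have h1 := strong_law_ae_real X
    ((h.identDistrib_interarrival 0).integrable_iff.2 (integrable_id_expMeasure hlam))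
    (fun i j hij => h.indep_interarrival.indepFun hij)
    (fun n => (h.identDistrib_interarrival n).trans (h.identDistrib_interarrival 0).symm)
  rw [(h.identDistrib_interarrival 0).integral_eq] at h1
  simp only [id] at h1
  rw [integral_id_expMeasure hlam] at h1
  filter_upwards [h1] with ω hω
  have h2 := (hω.comp (tendsto_add_atTop_nat 1)).mul
    ((tendsto_natCast_div_add_atTop (1 : ℝ)).inv₀ one_ne_zero)
  rw [inv_one, mul_one] at h2
  refine h2.congr' ?_
  filter_upwards [eventually_gt_atTop 0] with n hn
  have : (n : ℝ) ≠ 0 := by positivity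
  simp only [Function.comp_apply, arrivalTime]
  push_cast
  field_simp

lemma ae_regularPath : ∀ᵐ ω ∂P, RegularPath (fun k => X k ω) (fun k => S k ω) := by
  have hX : ∀ᵐ ω ∂P, ∀ n, 0 < X n ω := ae_all_iff.2 fun n => by
    have := ae_expMeasure_pos hlam
    rw [← h.law_interarrival n] at this
    exact ae_of_ae_map (h.measurable_interarrival n).aemeasurable this
  filter_upwards [hX, h.ae_service_nonneg, h.ae_tendsto_arrivalTime_div hlam] with ω h1 h2 h3
  exact ⟨h1, h2, tendsto_atTop_of_tendsto_div (by positivity) h3⟩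

/-- Given the sojourn time `v` of a customer, the number left behind has the Poisson distribution
of mean `lam * v`. -/
lemma measureReal_q_eq (n k : ℕ) : P.real {ω | q X S n ω = k} =
    ∫ ω, poissonWeight k (lam * sojournTime (fun k => X k ω) (fun k => S k ω) n) ∂P := by
  have := h.isProbabilityMeasure
  have := isProbabilityMeasure_expMeasure hlam
  have hm := h.measurable_sojournTime n
  have htail : Measurable fun ω m => X (n + 1 + m) ω :=
    measurable_pi_lambda _ fun m => h.measurable_interarrival (n + 1 + m)
  have hind : IndepFun (fun ω => sojournTime (fun k => X k ω) (fun k => S k ω) n)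
      (fun ω m => X (n + 1 + m) ω) P :=
    (h.indepFun_waitingTime_tail n).comp (φ := fun p : ℝ × ℝ => p.1 + p.2) (ψ := id)
      (by fun_prop) measurable_id
  have hs : MeasurableSet {p : ℝ × (ℕ → ℝ) | CountIs p.2 p.1 k} :=
    measurableSet_countIs measurable_snd measurable_fst k
  have h1 : P.real {ω | q X S n ω = k} = P.real ((fun ω =>
      (sojournTime (fun k => X k ω) (fun k => S k ω) n, fun m => X (n + 1 + m) ω)) ⁻¹'
      {p : ℝ × (ℕ → ℝ) | CountIs p.2 p.1 k}) := by
    refine measureReal_congr ?_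
    filter_upwards [h.ae_regularPath hlam] with ω hω
    exact propext hω.numberLeftBehind_eq_iff
  have := Measure.isProbabilityMeasure_map (μ := P) hm.aemeasurable
  rw [h1, ← map_measureReal_apply (hm.prodMk htail) hs,
    hind.map_prod_eq_prod_map_map hm.aemeasurable htail.aemeasurable, h.map_tail,
    measureReal_prod_apply' _ _ hs, integral_map hm.aemeasurable]
  · refine integral_congr_ae ?_
    filter_upwards [h.ae_regularPath hlam] with ω hω
    exact measureReal_countIs hlam (sojournTime_nonneg hω.service_nonneg n) k
  · exact ((measurable_measure_prodMk_left hs).ennreal_toReal).aestronglyMeasurable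

/-- Given the service time `s` of a customer, the number of arrivals during the service has the
Poisson distribution of mean `lam * s`. -/
lemma measureReal_a_eq (n k : ℕ) : P.real {ω | a X S n ω = k} =
    ∫ ω, poissonWeight k (lam * S 0 ω) ∂P := by
  have := h.isProbabilityMeasure
  have := isProbabilityMeasure_expMeasure hlam
  have hm := (h.measurable_waitingTime n).prodMk (h.measurable_service n)
  have htail : Measurable fun ω m => X (n + 1 + m) ω :=
    measurable_pi_lambda _ fun m => h.measurable_interarrival (n + 1 + m)
  have hind := h.indepFun_waitingTime_tail n
  have hs : MeasurableSet {p : (ℝ × ℝ) × (ℕ → ℝ) |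
      ∃ j, CountIs p.2 p.1.1 j ∧ CountIs p.2 (p.1.1 + p.1.2) (j + k)} := by
    have : {p : (ℝ × ℝ) × (ℕ → ℝ) | ∃ j, CountIs p.2 p.1.1 j ∧
        CountIs p.2 (p.1.1 + p.1.2) (j + k)} = ⋃ j, {p : (ℝ × ℝ) × (ℕ → ℝ) |
        CountIs p.2 p.1.1 j ∧ CountIs p.2 (p.1.1 + p.1.2) (j + k)} := by
      ext p; simp
    rw [this]
    exact MeasurableSet.iUnion fun j =>
      (measurableSet_countIs measurable_snd (measurable_fst.comp measurable_fst) j).inter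
      (measurableSet_countIs measurable_snd
        ((measurable_fst.comp measurable_fst).add (measurable_snd.comp measurable_fst)) (j + k))
  have h1 : P.real {ω | a X S n ω = k} = P.real ((fun ω =>
      ((waitingTime (fun k => X k ω) (fun k => S k ω) n, S n ω), fun m => X (n + 1 + m) ω)) ⁻¹'
      {p : (ℝ × ℝ) × (ℕ → ℝ) |
        ∃ j, CountIs p.2 p.1.1 j ∧ CountIs p.2 (p.1.1 + p.1.2) (j + k)}) := by
    refine measureReal_congr ?_
    filter_upwards [h.ae_regularPath hlam] with ω hω
    exact propext hω.arrivalsDuringService_eq_iff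
  have := Measure.isProbabilityMeasure_map (μ := P) hm.aemeasurable
  rw [h1, ← map_measureReal_apply (hm.prodMk htail) hs,
    hind.map_prod_eq_prod_map_map hm.aemeasurable htail.aemeasurable, h.map_tail,
    measureReal_prod_apply' _ _ hs, integral_map hm.aemeasurable]
  · have hid := ((h.identDistrib_service n).comp (u := fun s => poissonWeight k (lam * s))
      ((continuous_poissonWeight k).measurable.comp (measurable_const_mul lam))).integral_eq
    refine Eq.trans ?_ hid
    refine integral_congr_ae ?_
    filter_upwards [h.ae_regularPath hlam] with ω hω
    exact measureReal_exists_countIs hlam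
      (waitingTime_nonneg (fun k => X k ω) (fun k => S k ω) n) (hω.service_nonneg n) k
  · exact ((measurable_measure_prodMk_left hs).ennreal_toReal).aestronglyMeasurable

end IsMG1

end Laws

/-! ### Moments from the Laplace transform -/

section Laplace

lemma tendsto_one_sub_exp_div (z : ℝ) :
    Tendsto (fun θ : ℝ => (1 - Real.exp (-(θ * z))) / θ) (𝓝[>] 0) (𝓝 z) := by
  have h : HasDerivAt (fun θ : ℝ => 1 - Real.exp (-(θ * z))) z 0 := by
    have h1 : HasDerivAt (fun θ : ℝ => -(θ * z)) (-(1 * z)) 0 :=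
      ((hasDerivAt_id 0).mul_const z).neg
    refine (h1.exp.const_sub 1).congr_deriv ?_
    simp
  have h2 := h.tendsto_slope_zero_right
  refine h2.congr fun θ => ?_
  simp [div_eq_inv_mul]

lemma tendsto_exp_sub_one_add_div (z : ℝ) :
    Tendsto (fun θ : ℝ => (θ * z - (1 - Real.exp (-(θ * z)))) / θ ^ 2) (𝓝[>] 0)
      (𝓝 (z ^ 2 / 2)) := by
  have hlim : Tendsto (fun θ : ℝ => θ * |z| ^ 3) (𝓝[>] 0) (𝓝 0) := by
    have : Tendsto (fun θ : ℝ => θ * |z| ^ 3) (𝓝 0) (𝓝 (0 * |z| ^ 3)) :=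
      tendsto_id.mul_const _
    rw [zero_mul] at this
    exact this.mono_left nhdsWithin_le_nhds
  have hsmall : ∀ᶠ θ : ℝ in 𝓝[>] 0, |θ * z| < 1 := by
    have : Tendsto (fun θ : ℝ => |θ * z|) (𝓝 0) (𝓝 |0 * z|) :=
      (tendsto_id.mul_const z).abs
    rw [zero_mul, abs_zero] at this
    exact (this.mono_left nhdsWithin_le_nhds).eventually_lt_const one_pos
  rw [tendsto_iff_dist_tendsto_zero]
  refine squeeze_zero' (Eventually.of_forall fun _ => dist_nonneg) ?_ hlim
  filter_upwards [hsmall, self_mem_nhdsWithin] with θ hθ hpos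
  have hpos : 0 < θ := hpos
  have hb := Real.exp_bound (x := -(θ * z)) (by rw [abs_neg]; exact hθ.le) (n := 3) (by norm_num)
  rw [abs_neg] at hb
  simp only [Finset.sum_range_succ, Finset.sum_range_zero] at hb
  norm_num [Nat.factorial] at hb
  have h1 : (θ * z - (1 - Real.exp (-(θ * z)))) / θ ^ 2 - z ^ 2 / 2 =
      (Real.exp (-(θ * z)) - (1 + -(θ * z) + (θ * z) ^ 2 / 2)) / θ ^ 2 := by
    field_simp; ring
  rw [Real.dist_eq, h1, abs_div, abs_of_pos (by positivity : 0 < θ ^ 2),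
    div_le_iff₀ (by positivity)]
  refine hb.trans ?_
  rw [abs_of_pos hpos, mul_pow]
  have : 0 ≤ |z| ^ 3 := by positivity
  have : 0 ≤ θ ^ 3 * |z| ^ 3 := by positivity
  nlinarith

lemma one_sub_exp_neg_div_le {θ z : ℝ} (hθ : 0 < θ) (hz : 0 ≤ z) :
    ‖(1 - Real.exp (-(θ * z))) / θ‖ ≤ z := by
  have h0 : Real.exp (-(θ * z)) ≤ 1 := Real.exp_le_one_iff.2 (by nlinarith)
  rw [Real.norm_of_nonneg (div_nonneg (by linarith) hθ.le), div_le_iff₀ hθ]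
  linarith [Real.one_sub_le_exp_neg (θ * z)]

lemma exp_sub_one_add_div_le {θ z : ℝ} (hθ : 0 < θ) (hz : 0 ≤ z) :
    ‖(θ * z - (1 - Real.exp (-(θ * z)))) / θ ^ 2‖ ≤ z ^ 2 := by
  have hx : 0 ≤ θ * z := by positivity
  have h1 := Real.one_sub_le_exp_neg (θ * z)
  rw [Real.norm_of_nonneg (div_nonneg (by linarith) (by positivity)), div_le_iff₀ (by positivity)]
  rcases le_or_gt (θ * z) 1 with h | h
  · have := (abs_le.1 (Real.abs_exp_sub_one_sub_id_le (x := -(θ * z))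
      (by rwa [abs_neg, abs_of_nonneg hx]))).2
    nlinarith
  · have : Real.exp (-(θ * z)) ≤ 1 := Real.exp_le_one_iff.2 (by linarith)
    nlinarith

variable {α : Type*} [MeasurableSpace α] {m : Measure α} [IsProbabilityMeasure m] {Z : α → ℝ}

lemma exp_neg_mul_norm_le_one {θ z : ℝ} (hθ : 0 ≤ θ) (hz : 0 ≤ z) : ‖Real.exp (-(θ * z))‖ ≤ 1 := by
  rw [Real.norm_of_nonneg (Real.exp_pos _).le, Real.exp_le_one_iff]
  nlinarith

lemma integrable_exp_neg_mul (hZ : Measurable Z) (hZ0 : ∀ᵐ a ∂m, 0 ≤ Z a) {θ : ℝ} (hθ : 0 ≤ θ) :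
    Integrable (fun a => Real.exp (-(θ * Z a))) m := by
  refine (integrable_const (1 : ℝ)).mono' (by fun_prop) ?_
  filter_upwards [hZ0] with a ha using exp_neg_mul_norm_le_one hθ ha

lemma tendsto_integral_exp_neg (hZ : Measurable Z) (hZ0 : ∀ᵐ a ∂m, 0 ≤ Z a) :
    Tendsto (fun θ : ℝ => ∫ a, Real.exp (-(θ * Z a)) ∂m) (𝓝[>] 0) (𝓝 1) := by
  have h := tendsto_integral_filter_of_dominated_convergence (μ := m) (l := 𝓝[>] (0 : ℝ))
    (F := fun θ a => Real.exp (-(θ * Z a))) (f := fun _ => 1) (fun _ => 1)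
    (Eventually.of_forall fun θ => by fun_prop)
    (by
      filter_upwards [self_mem_nhdsWithin] with θ hθ
      filter_upwards [hZ0] with a ha using exp_neg_mul_norm_le_one (le_of_lt hθ) ha)
    (integrable_const _)
    (Eventually.of_forall fun a => by
      have h1 : Continuous fun θ : ℝ => Real.exp (-(θ * Z a)) := by fun_prop
      have h2 := h1.tendsto 0
      simp only [zero_mul, neg_zero, Real.exp_zero] at h2
      exact h2.mono_left nhdsWithin_le_nhds)
  simpa using h

lemma tendsto_one_sub_integral_exp_neg_div (hZ : Measurable Z) (hZ0 : ∀ᵐ a ∂m, 0 ≤ Z a)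
    (hi : Integrable Z m) :
    Tendsto (fun θ : ℝ => (1 - ∫ a, Real.exp (-(θ * Z a)) ∂m) / θ) (𝓝[>] 0) (𝓝 (∫ a, Z a ∂m)) := by
  have h := tendsto_integral_filter_of_dominated_convergence (μ := m) (l := 𝓝[>] (0 : ℝ))
    (F := fun θ a => (1 - Real.exp (-(θ * Z a))) / θ) (f := Z) Z
    (Eventually.of_forall fun θ => by fun_prop)
    (by
      filter_upwards [self_mem_nhdsWithin] with θ hθ
      filter_upwards [hZ0] with a ha using one_sub_exp_neg_div_le hθ ha)
    hi (Eventually.of_forall fun a => tendsto_one_sub_exp_div (Z a))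
  refine h.congr' ?_
  filter_upwards [self_mem_nhdsWithin] with θ hθ
  rw [integral_div, integral_sub (integrable_const _) (integrable_exp_neg_mul hZ hZ0 (le_of_lt hθ))]
  simp

lemma tendsto_sub_one_add_integral_exp_neg_div (hZ : Measurable Z) (hZ0 : ∀ᵐ a ∂m, 0 ≤ Z a)
    (hi : Integrable Z m) (hi2 : Integrable (fun a => Z a ^ 2) m) :
    Tendsto (fun θ : ℝ => (θ * ∫ a, Z a ∂m - (1 - ∫ a, Real.exp (-(θ * Z a)) ∂m)) / θ ^ 2) (𝓝[>] 0)
      (𝓝 ((∫ a, Z a ^ 2 ∂m) / 2)) := by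
  have h := tendsto_integral_filter_of_dominated_convergence (μ := m) (l := 𝓝[>] (0 : ℝ))
    (F := fun θ a => (θ * Z a - (1 - Real.exp (-(θ * Z a)))) / θ ^ 2) (f := fun a => Z a ^ 2 / 2)
    (fun a => Z a ^ 2) (Eventually.of_forall fun θ => by fun_prop)
    (by
      filter_upwards [self_mem_nhdsWithin] with θ hθ
      filter_upwards [hZ0] with a ha using exp_sub_one_add_div_le hθ ha)
    hi2 (Eventually.of_forall fun a => tendsto_exp_sub_one_add_div (Z a))
  rw [integral_div] at h
  refine h.congr' ?_
  filter_upwards [self_mem_nhdsWithin] with θ hθ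
  have he := integrable_exp_neg_mul hZ hZ0 (le_of_lt hθ) (m := m)
  have hd : Integrable (fun a => 1 - Real.exp (-(θ * Z a))) m := (integrable_const _).sub he
  rw [integral_div, integral_sub (hi.const_mul θ) hd,
    integral_sub (integrable_const _) he, integral_const_mul]
  simp

/-- A nonnegative random variable has a finite mean if its Laplace transform is differentiable at
`0`. -/
lemma integrable_and_integral_eq_of_tendsto (hZ : Measurable Z) (hZ0 : ∀ᵐ a ∂m, 0 ≤ Z a) {c : ℝ}
    (h : Tendsto (fun θ : ℝ => (1 - ∫ a, Real.exp (-(θ * Z a)) ∂m) / θ) (𝓝[>] 0) (𝓝 c)) :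
    Integrable Z m ∧ ∫ a, Z a ∂m = c := by
  have hi : Integrable Z m := by
    set θ : ℕ → ℝ := fun n => 1 / ((n : ℝ) + 1)
    have hθpos : ∀ n, 0 < θ n := fun n => by positivity
    have hθ : Tendsto θ atTop (𝓝[>] 0) :=
      tendsto_nhdsWithin_iff.2 ⟨tendsto_one_div_add_atTop_nhds_zero_nat,
        Eventually.of_forall hθpos⟩
    set f : ℕ → α → ℝ := fun n a => (1 - Real.exp (-(θ n * Z a))) / θ n
    have hfm : ∀ n, Measurable (f n) := fun n => by fun_prop
    have hf0 : ∀ n, 0 ≤ᵐ[m] f n := fun n => by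
      filter_upwards [hZ0] with a ha
      refine div_nonneg (sub_nonneg.2 (Real.exp_le_one_iff.2 ?_)) (hθpos n).le
      nlinarith [hθpos n]
    have hfi : ∀ n, Integrable (f n) m := fun n =>
      ((integrable_const _).sub (integrable_exp_neg_mul hZ hZ0 (hθpos n).le)).div_const _
    have hint : ∀ n, ∫⁻ a, ENNReal.ofReal (f n a) ∂m =
        ENNReal.ofReal ((1 - ∫ a, Real.exp (-(θ n * Z a)) ∂m) / θ n) := fun n => by
      rw [← ofReal_integral_eq_lintegral_ofReal (hfi n) (hf0 n)]
      simp only [f]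
      rw [integral_div, integral_sub (integrable_const _)
        (integrable_exp_neg_mul hZ hZ0 (hθpos n).le)]
      simp
    have hfatou := lintegral_liminf_le (μ := m) (u := atTop)
      (f := fun n a => ENNReal.ofReal (f n a)) fun n => (hfm n).ennreal_ofReal
    simp_rw [hint] at hfatou
    have hlim : liminf (fun n => ENNReal.ofReal ((1 - ∫ a, Real.exp (-(θ n * Z a)) ∂m) / θ n))
        atTop = ENNReal.ofReal c :=
      ((ENNReal.continuous_ofReal.tendsto c).comp (h.comp hθ)).liminf_eq
    rw [hlim] at hfatou
    have hpt : ∀ a, liminf (fun n => ENNReal.ofReal (f n a)) atTop = ENNReal.ofReal (Z a) :=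
      fun a => ((ENNReal.continuous_ofReal.tendsto _).comp
        ((tendsto_one_sub_exp_div (Z a)).comp hθ)).liminf_eq
    simp_rw [hpt] at hfatou
    refine ⟨hZ.aestronglyMeasurable, ?_⟩
    rw [hasFiniteIntegral_iff_ofReal hZ0]
    exact hfatou.trans_lt ENNReal.ofReal_lt_top
  exact ⟨hi, tendsto_nhds_unique (tendsto_one_sub_integral_exp_neg_div hZ hZ0 hi) h⟩

end Laplace

/-! ### Uniqueness of the steady state -/

/-- The transition probability from `i + 1` to `j` is that of `j - i` arrivals, so the steady-state
equation for `j` is a finite sum. -/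
lemma isSteadyState_iff {Ω : Type*} [MeasurableSpace Ω] {P : Measure Ω} {α : Ω → ℕ} {K : ℕ → ℝ}
    (hK : ∀ k, P.real {ω | α ω = k} = K k) {p : ℕ → ℝ} :
    IsSteadyState P α p ↔
      ∀ j, p j = p 0 * K j + ∑ i ∈ Finset.range (j + 1), p (i + 1) * K (j - i) := by
  refine forall_congr' fun j => ?_
  have h0 : P.real {ω | ((0 : ℕ) : ℤ) + (α ω : ℤ) - (busyIndicator 0 : ℤ) = (j : ℤ)} = K j := by
    rw [← hK]
    congr 1; ext ω
    simp [busyIndicator]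
  have hsucc : ∀ i, P.real {ω | ((i + 1 : ℕ) : ℤ) + (α ω : ℤ) - (busyIndicator (i + 1) : ℤ) =
      (j : ℤ)} = if i ≤ j then K (j - i) else 0 := by
    intro i
    split_ifs with hij
    · rw [← hK]
      congr 1; ext ω
      simp only [busyIndicator, Set.mem_ofPred_eq]
      rw [if_pos (Nat.succ_pos i)]
      push_cast
      omega
    · have : {ω | ((i + 1 : ℕ) : ℤ) + (α ω : ℤ) - (busyIndicator (i + 1) : ℤ) = (j : ℤ)} = ∅ := by
        ext ω
        simp only [busyIndicator, Set.mem_ofPred_eq, Set.mem_empty_iff_false, iff_false]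
        rw [if_pos (Nat.succ_pos i)]
        push_cast
        omega
      rw [this, measureReal_empty]
  have hsum : HasSum (fun i : ℕ => p i * P.real {ω | (i : ℤ) + (α ω : ℤ) - (busyIndicator i : ℤ) =
      (j : ℤ)}) (p 0 * K j + ∑ i ∈ Finset.range (j + 1), p (i + 1) * K (j - i)) := by
    rw [← hasSum_nat_add_iff' 1, Finset.sum_range_one, h0, add_sub_cancel_left]
    have : ∑ i ∈ Finset.range (j + 1), p (i + 1) * K (j - i) =
        ∑ i ∈ Finset.range (j + 1), p (i + 1) * P.real {ω | ((i + 1 : ℕ) : ℤ) + (α ω : ℤ) -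
          (busyIndicator (i + 1) : ℤ) = (j : ℤ)} := by
      refine Finset.sum_congr rfl fun i hi => ?_
      rw [hsucc, if_pos (Nat.lt_succ_iff.1 (Finset.mem_range.1 hi))]
    rw [this]
    refine hasSum_sum_of_ne_finset_zero fun i hi => ?_
    rw [hsucc, if_neg (fun h => hi (Finset.mem_range.2 (Nat.lt_succ_iff.2 h))), mul_zero]
  exact ⟨fun h => h.unique hsum, fun h => by rw [h]; exact hsum⟩

/-- The steady-state equations can be solved successively for `p 1, p 2, …`, so they determine a
distribution up to the factor `p 0`, and this factor is fixed by the normalization. -/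
lemma IsDistribution.eq_of_steadyState {K p p' : ℕ → ℝ} (hK : 0 < K 0) (hp : IsDistribution p)
    (hp' : IsDistribution p')
    (h : ∀ j, p j = p 0 * K j + ∑ i ∈ Finset.range (j + 1), p (i + 1) * K (j - i))
    (h' : ∀ j, p' j = p' 0 * K j + ∑ i ∈ Finset.range (j + 1), p' (i + 1) * K (j - i)) :
    p' = p := by
  have key : ∀ j, p 0 * p' j = p' 0 * p j := by
    intro j
    induction j using Nat.strong_induction_on with
    | _ j ih =>
      rcases j with _ | j
      · ring
      · have e := h j
        have e' := h' j
        rw [Finset.sum_range_succ, Nat.sub_self] at e e'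
        have hs : p 0 * ∑ i ∈ Finset.range j, p' (i + 1) * K (j - i) =
            p' 0 * ∑ i ∈ Finset.range j, p (i + 1) * K (j - i) := by
          rw [Finset.mul_sum, Finset.mul_sum]
          refine Finset.sum_congr rfl fun i hi => ?_
          rw [← mul_assoc, ← mul_assoc, ih (i + 1) (by have := Finset.mem_range.1 hi; omega)]
        have hj := ih j (Nat.lt_succ_self j)
        refine mul_right_cancel₀ hK.ne' ?_
        linear_combination p' 0 * e - p 0 * e' + hj - hs
  have h0 : p 0 = p' 0 := by
    have h1 := hp'.2.mul_left (p 0)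
    have h2 := hp.2.mul_left (p' 0)
    simp_rw [key] at h1
    simpa using h1.unique h2
  have hpos : p 0 ≠ 0 := by
    intro hz
    have hall : ∀ j, p j = 0 := by
      intro j
      induction j using Nat.strong_induction_on with
      | _ j ih =>
        rcases j with _ | j
        · exact hz
        · have e := h j
          rw [Finset.sum_range_succ, Nat.sub_self, ih j (Nat.lt_succ_self j), hz,
            Finset.sum_eq_zero fun i hi => by
              rw [ih (i + 1) (by have := Finset.mem_range.1 hi; omega), zero_mul]] at e
          have : p (j + 1) * K 0 = 0 := by linarith
          exact (mul_eq_zero.1 this).resolve_right hK.ne'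
    have h1 := hp.2
    rw [show p = fun _ => 0 from funext hall] at h1
    exact zero_ne_one (hasSum_zero.unique h1)
  funext j
  have := key j
  rw [← h0] at this
  exact mul_left_cancel₀ hpos this

/-! ### The limiting distribution -/

section Limit

variable {Ω : Type*} [MeasurableSpace Ω] {P : Measure Ω} {lam mu sigma : ℝ} {X S : ℕ → Ω → ℝ}

/-- The law of the two-sided stationary sequence of the differences between a service time and the
inter-arrival time that follows it. -/
noncomputable def driveLaw (P : Measure Ω) (X S : ℕ → Ω → ℝ) : Measure (ℤ → ℝ) :=
  Measure.infinitePi fun _ : ℤ => P.map fun ω => S 0 ω - X 1 ω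

/-- The stationary sojourn time: the stationary waiting time plus an independent service time. -/
noncomputable def stationarySojourn (S : ℕ → Ω → ℝ) (p : Ω × (ℤ → ℝ)) : ℝ :=
  S 0 p.1 + stationaryLindley p.2

/-- The limiting distribution of the number left behind: a Poisson distribution mixed over the
stationary sojourn time. -/
noncomputable def limitDist (P : Measure Ω) (lam : ℝ) (X S : ℕ → Ω → ℝ) (k : ℕ) : ℝ :=
  ∫ p, poissonWeight k (lam * stationarySojourn S p) ∂(P.prod (driveLaw P X S))

namespace IsMG1

variable (h : IsMG1 P lam mu sigma X S)
include h

lemma measurable_difference : Measurable fun ω => S 0 ω - X 1 ω :=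
  (h.measurable_service 0).sub (h.measurable_interarrival 1)

lemma isProbabilityMeasure_difference :
    IsProbabilityMeasure (P.map fun ω => S 0 ω - X 1 ω) :=
  have := h.isProbabilityMeasure
  Measure.isProbabilityMeasure_map h.measurable_difference.aemeasurable

lemma isProbabilityMeasure_driveLaw : IsProbabilityMeasure (driveLaw P X S) := by
  have := h.isProbabilityMeasure_difference
  unfold driveLaw
  infer_instance

lemma measurable_stationarySojourn : Measurable (stationarySojourn S) :=
  ((h.measurable_service 0).comp measurable_fst).add
    (measurable_stationaryLindley.comp measurable_snd)

lemma map_waitingTime (n : ℕ) :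
    P.map (fun ω => waitingTime (fun k => X k ω) (fun k => S k ω) n) =
      (driveLaw P X S).map (lindleyFrom n) := by
  have := h.isProbabilityMeasure_difference
  exact map_lindley_eq_map_lindleyFrom
    (fun k => (h.measurable_service k).sub (h.measurable_interarrival (k + 1)))
    h.iIndepFun_service_sub_interarrival h.map_service_sub_interarrival n

/-- The sojourn time of customer `n` has the law of a service time plus an independent copy of
`lindleyFrom n`. -/
lemma integral_sojournTime_eq (n : ℕ) {f : ℝ → ℝ} (hf : Measurable f) :
    ∫ ω, f (sojournTime (fun k => X k ω) (fun k => S k ω) n) ∂P =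
      ∫ p, f (S 0 p.1 + lindleyFrom n p.2) ∂(P.prod (driveLaw P X S)) := by
  have := h.isProbabilityMeasure
  have := h.isProbabilityMeasure_driveLaw
  have hW := h.measurable_waitingTime n
  have hS := h.measurable_service n
  have hadd : Measurable fun p : ℝ × ℝ => f (p.1 + p.2) := hf.comp (by fun_prop)
  have hmap : P.map (fun ω => (S n ω, waitingTime (fun k => X k ω) (fun k => S k ω) n)) =
      (P.prod (driveLaw P X S)).map (Prod.map (S 0) (lindleyFrom n)) := by
    rw [(h.indepFun_waitingTime_service n).symm.map_prod_eq_prod_map_map hS.aemeasurable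
      hW.aemeasurable, h.map_service, h.map_waitingTime,
      Measure.map_prod_map _ _ (h.measurable_service 0) (measurable_lindleyFrom n)]
  have h1 : ∫ ω, f (sojournTime (fun k => X k ω) (fun k => S k ω) n) ∂P =
      ∫ p, f (p.1 + p.2) ∂(P.map fun ω =>
        (S n ω, waitingTime (fun k => X k ω) (fun k => S k ω) n)) := by
    rw [integral_map (hS.prodMk hW).aemeasurable hadd.aestronglyMeasurable]
    refine integral_congr_ae (Eventually.of_forall fun ω => ?_)
    simp only [sojournTime]
    rw [add_comm]
  rw [h1, hmap, integral_map ((h.measurable_service 0).prodMap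
    (measurable_lindleyFrom n)).aemeasurable hadd.aestronglyMeasurable]
  rfl

lemma ae_prod_service_nonneg : ∀ᵐ p ∂(P.prod (driveLaw P X S)), 0 ≤ S 0 p.1 := by
  have := h.isProbabilityMeasure
  have := h.isProbabilityMeasure_driveLaw
  exact Measure.quasiMeasurePreserving_fst.ae (h.service_nonneg 0)

lemma ae_stationarySojourn_nonneg :
    ∀ᵐ p ∂(P.prod (driveLaw P X S)), 0 ≤ stationarySojourn S p := by
  filter_upwards [h.ae_prod_service_nonneg] with p hp
  exact add_nonneg hp (stationaryLindley_nonneg _)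

variable (hlam : 0 < lam)
include hlam

lemma integrable_difference : Integrable id (P.map fun ω => S 0 ω - X 1 ω) :=
  (integrable_map_measure measurable_id.aestronglyMeasurable
    h.measurable_difference.aemeasurable).2 (h.integrable_service.sub
      ((h.identDistrib_interarrival 1).integrable_iff.2 (integrable_id_expMeasure hlam)))

lemma integral_difference :
    ∫ x, x ∂(P.map fun ω => S 0 ω - X 1 ω) = 1 / mu - 1 / lam := by
  have hX := h.identDistrib_interarrival 1
  have hXm := hX.integral_eq
  simp only [id] at hXm
  rw [integral_id_expMeasure hlam] at hXm
  have hmap := integral_map (f := id) h.measurable_difference.aemeasurable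
    measurable_id.aestronglyMeasurable (μ := P)
  simp only [id] at hmap
  rw [hmap, integral_sub h.integrable_service (hX.integrable_iff.2 (integrable_id_expMeasure hlam)),
    h.mean_service, hXm]

variable (hlt : lam < mu)
include hlt

lemma integral_difference_neg : ∫ x, x ∂(P.map fun ω => S 0 ω - X 1 ω) < 0 := by
  rw [h.integral_difference hlam, sub_neg]
  exact one_div_lt_one_div_of_lt hlam hlt

lemma ae_tendsto_lindleyFrom_drive : ∀ᵐ y ∂(driveLaw P X S),
    Tendsto (fun n => lindleyFrom n y) atTop (𝓝 (stationaryLindley y)) := by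
  have := h.isProbabilityMeasure_difference
  exact ae_tendsto_lindleyFrom (h.integrable_difference hlam) (h.integral_difference_neg hlam hlt)

lemma tendsto_integral_waitingTime {f : ℝ → ℝ} (hf : Continuous f) {C : ℝ}
    (hC : ∀ v, 0 ≤ v → ‖f v‖ ≤ C) :
    Tendsto (fun n => ∫ ω, f (waitingTime (fun k => X k ω) (fun k => S k ω) n) ∂P) atTop
      (𝓝 (∫ y, f (stationaryLindley y) ∂(driveLaw P X S))) := by
  have := h.isProbabilityMeasure_driveLaw
  have heq : ∀ n, ∫ ω, f (waitingTime (fun k => X k ω) (fun k => S k ω) n) ∂P =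
      ∫ y, f (lindleyFrom n y) ∂(driveLaw P X S) := fun n => by
    rw [← integral_map (measurable_lindleyFrom n).aemeasurable
      hf.measurable.aestronglyMeasurable, ← h.map_waitingTime,
      integral_map (h.measurable_waitingTime n).aemeasurable hf.measurable.aestronglyMeasurable]
  simp_rw [heq]
  refine tendsto_integral_of_dominated_convergence (fun _ => C)
    (fun n => (hf.measurable.comp (measurable_lindleyFrom n)).aestronglyMeasurable)
    (integrable_const _) (fun n => Eventually.of_forall fun y => hC _ (lindleyFrom_nonneg n y)) ?_
  filter_upwards [h.ae_tendsto_lindleyFrom_drive hlam hlt] with y hy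
  exact (hf.tendsto _).comp hy

lemma tendsto_integral_sojournTime {f : ℝ → ℝ} (hf : Continuous f) {C : ℝ}
    (hC : ∀ v, 0 ≤ v → ‖f v‖ ≤ C) :
    Tendsto (fun n => ∫ ω, f (sojournTime (fun k => X k ω) (fun k => S k ω) n) ∂P) atTop
      (𝓝 (∫ p, f (stationarySojourn S p) ∂(P.prod (driveLaw P X S)))) := by
  have := h.isProbabilityMeasure
  have := h.isProbabilityMeasure_driveLaw
  simp_rw [fun n => h.integral_sojournTime_eq n hf.measurable]
  refine tendsto_integral_of_dominated_convergence (fun _ => C)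
    (fun n => (hf.measurable.comp (((h.measurable_service 0).comp measurable_fst).add
      ((measurable_lindleyFrom n).comp measurable_snd))).aestronglyMeasurable)
    (integrable_const _) (fun n => ?_) ?_
  · filter_upwards [h.ae_prod_service_nonneg] with p hp
    exact hC _ (add_nonneg hp (lindleyFrom_nonneg n p.2))
  · filter_upwards [Measure.quasiMeasurePreserving_snd.ae
      (h.ae_tendsto_lindleyFrom_drive hlam hlt)] with p hp
    exact (hf.tendsto _).comp (hp.const_add _)

lemma tendsto_measureReal_q (k : ℕ) : Tendsto (fun n => P.real {ω | q X S n ω = k}) atTop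
    (𝓝 (limitDist P lam X S k)) := by
  simp_rw [fun n => h.measureReal_q_eq hlam n k]
  exact h.tendsto_integral_sojournTime hlam hlt (continuous_poissonWeight_mul lam k)
    (norm_poissonWeight_mul_le_one hlam k)

end IsMG1

end Limit

/-! ### The steady-state equations and the mean of the limiting distribution -/

section Mean

variable {Ω : Type*} [MeasurableSpace Ω] {P : Measure Ω} {lam mu sigma : ℝ} {X S : ℕ → Ω → ℝ}

namespace IsMG1

variable (h : IsMG1 P lam mu sigma X S)
include h

lemma ae_sojournTime_nonneg (n : ℕ) :
    ∀ᵐ ω ∂P, 0 ≤ sojournTime (fun k => X k ω) (fun k => S k ω) n := by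
  filter_upwards [h.ae_service_nonneg] with ω hω
  exact sojournTime_nonneg (x := fun k => X k ω) hω n

lemma integral_service_sq : ∫ ω, S 0 ω ^ 2 ∂P = sigma ^ 2 + (1 / mu) ^ 2 := by
  have := h.isProbabilityMeasure
  have hv := variance_eq_sub h.memLp_service
  rw [h.variance_service, h.mean_service] at hv
  have : ∫ ω, (S 0 ^ 2) ω ∂P = ∫ ω, S 0 ω ^ 2 ∂P := rfl
  linarith

/-- The expectation over the next waiting time, given the sojourn time of the current customer. -/
lemma integral_waitingTime_succ (n : ℕ) {f : ℝ → ℝ} (hf : Continuous f) {C : ℝ}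
    (hC : ∀ v, 0 ≤ v → ‖f v‖ ≤ C) :
    ∫ ω, f (waitingTime (fun k => X k ω) (fun k => S k ω) (n + 1)) ∂P =
      ∫ ω, ∫ x, f (max 0 (sojournTime (fun k => X k ω) (fun k => S k ω) n - x))
        ∂(expMeasure lam) ∂P := by
  have := h.isProbabilityMeasure
  have hV := h.measurable_sojournTime n
  have hX := h.measurable_interarrival (n + 1)
  have hm : Measurable (Function.uncurry fun v x : ℝ => f (max 0 (v - x))) :=
    hf.measurable.comp (by fun_prop)
  rw [← h.law_interarrival (n + 1), ← integral_prod_of_indepFun hV hX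
    (h.indepFun_sojournTime_interarrival n) hm]
  · simp_rw [waitingTime_succ]
  · exact (integrable_const C).mono' (hm.comp (hV.prodMk hX)).aestronglyMeasurable
      (Eventually.of_forall fun ω => hC _ (le_max_left _ _))

variable (hlam : 0 < lam)
include hlam

/-- The transition of the numbers left behind from one departure to the next, expressed by the
mixed Poisson probabilities. -/
lemma integral_poissonWeight_sojournTime_succ (n j : ℕ) :
    ∫ ω, poissonWeight j (lam * sojournTime (fun k => X k ω) (fun k => S k ω) (n + 1)) ∂P =
      ∑ i ∈ Finset.range (j + 1),
        (∫ ω, poissonWeight (i + 1) (lam * sojournTime (fun k => X k ω) (fun k => S k ω) n) ∂P +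
          if i = 0 then
            ∫ ω, poissonWeight 0 (lam * sojournTime (fun k => X k ω) (fun k => S k ω) n) ∂P
          else 0) * ∫ ω, poissonWeight (j - i) (lam * S 0 ω) ∂P := by
  have := h.isProbabilityMeasure
  have hW := h.measurable_waitingTime (n + 1)
  have hS := h.measurable_service (n + 1)
  have hV := h.measurable_sojournTime n
  have hpm := fun k => (continuous_poissonWeight_mul lam k).measurable
  -- the next waiting time, by the loss of memory of the exponential distribution
  have hwait : ∀ i, ∫ ω, poissonWeight i
      (lam * waitingTime (fun k => X k ω) (fun k => S k ω) (n + 1)) ∂P =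
      ∫ ω, poissonWeight (i + 1) (lam * sojournTime (fun k => X k ω) (fun k => S k ω) n) ∂P +
        if i = 0 then
          ∫ ω, poissonWeight 0 (lam * sojournTime (fun k => X k ω) (fun k => S k ω) n) ∂P
        else 0 := by
    intro i
    rw [h.integral_waitingTime_succ n (continuous_poissonWeight_mul lam i)
      (norm_poissonWeight_mul_le_one hlam i)]
    have h1 : ∫ ω, ∫ x, poissonWeight i (lam * max 0 (sojournTime (fun k => X k ω)
        (fun k => S k ω) n - x)) ∂(expMeasure lam) ∂P =
        ∫ ω, (poissonWeight (i + 1) (lam * sojournTime (fun k => X k ω) (fun k => S k ω) n) +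
          if i = 0 then poissonWeight 0 (lam * sojournTime (fun k => X k ω) (fun k => S k ω) n)
          else 0) ∂P := by
      refine integral_congr_ae ?_
      filter_upwards [h.ae_sojournTime_nonneg n] with ω hω
      exact integral_poissonWeight_max hlam hω i
    rw [h1]
    have hi := fun k => integrable_poissonWeight hlam hV (h.ae_sojournTime_nonneg n) k
    split_ifs
    · exact integral_add (hi _) (hi _)
    · simp
  have hservice : ∀ l, ∫ ω, poissonWeight l (lam * S (n + 1) ω) ∂P =
      ∫ ω, poissonWeight l (lam * S 0 ω) ∂P := fun l =>
    ((h.identDistrib_service (n + 1)).comp (hpm l)).integral_eq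
  have hmul : ∀ i l, ∫ ω, poissonWeight i (lam * waitingTime (fun k => X k ω) (fun k => S k ω)
      (n + 1)) * poissonWeight l (lam * S (n + 1) ω) ∂P =
      (∫ ω, poissonWeight i (lam * waitingTime (fun k => X k ω) (fun k => S k ω) (n + 1)) ∂P) *
        ∫ ω, poissonWeight l (lam * S (n + 1) ω) ∂P := fun i l =>
    (h.indepFun_waitingTime_service (n + 1)).integral_fun_comp_mul_comp hW.aemeasurable
      hS.aemeasurable (f := fun v => poissonWeight i (lam * v))
      (g := fun v => poissonWeight l (lam * v)) (hpm i).aestronglyMeasurable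
      (hpm l).aestronglyMeasurable
  simp only [sojournTime, mul_add, poissonWeight_add] at hwait ⊢
  rw [integral_finsetSum]
  · rw [Finset.Nat.sum_antidiagonal_eq_sum_range_succ_mk]
    refine Finset.sum_congr rfl fun i _ => ?_
    dsimp only
    rw [hmul, hservice, hwait]
  · intro i _
    have h1 := (integrable_poissonWeight hlam hS (h.service_nonneg (n + 1)) i.2)
    refine h1.bdd_mul (c := 1) ((hpm i.1).comp hW).aestronglyMeasurable
      (Eventually.of_forall fun ω => norm_poissonWeight_mul_le_one hlam i.1 _
        (waitingTime_nonneg _ _ _))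

lemma isDistribution_limitDist : IsDistribution (limitDist P lam X S) := by
  have := h.isProbabilityMeasure
  have := h.isProbabilityMeasure_driveLaw
  have hV := h.measurable_stationarySojourn
  have h0 := h.ae_stationarySojourn_nonneg
  refine ⟨fun k => integral_nonneg_of_ae ?_, ?_⟩
  · filter_upwards [h0] with p hp using poissonWeight_nonneg k (by positivity)
  · have hs : ∀ᵐ p ∂(P.prod (driveLaw P X S)),
        HasSum (fun k => poissonWeight k (lam * stationarySojourn S p)) 1 := by
      filter_upwards [h0] with p hp using hasSum_poissonWeight (by positivity)
    have := hasSum_integral_of_dominated_convergence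
      (μ := P.prod (driveLaw P X S)) (F := fun k p => poissonWeight k (lam * stationarySojourn S p))
      (f := fun _ => 1) (fun k p => poissonWeight k (lam * stationarySojourn S p))
      (fun k => ((continuous_poissonWeight_mul lam k).measurable.comp hV).aestronglyMeasurable)
      (fun k => by
        filter_upwards [h0] with p hp
        rw [Real.norm_of_nonneg (poissonWeight_nonneg k (by positivity))])
      (hs.mono fun p hp => hp.summable)
      ((integrable_const (1 : ℝ)).congr (hs.mono fun p hp => hp.tsum_eq.symm)) hs
    rw [integral_const, probReal_univ, one_smul] at this
    exact this

variable (hlt : lam < mu)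
include hlt

lemma tendsto_integral_poissonWeight (k : ℕ) :
    Tendsto (fun n => ∫ ω, poissonWeight k
      (lam * sojournTime (fun k => X k ω) (fun k => S k ω) n) ∂P) atTop
      (𝓝 (limitDist P lam X S k)) :=
  h.tendsto_integral_sojournTime hlam hlt (continuous_poissonWeight_mul lam k)
    (norm_poissonWeight_mul_le_one hlam k)

/-- The limiting distribution satisfies the steady-state equations. -/
lemma limitDist_eq (j : ℕ) : limitDist P lam X S j =
    limitDist P lam X S 0 * (∫ ω, poissonWeight j (lam * S 0 ω) ∂P) +
      ∑ i ∈ Finset.range (j + 1),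
        limitDist P lam X S (i + 1) * ∫ ω, poissonWeight (j - i) (lam * S 0 ω) ∂P := by
  have hlim := h.tendsto_integral_poissonWeight hlam hlt
  have h1 := (tendsto_add_atTop_iff_nat 1).2 (hlim j)
  simp_rw [fun n => h.integral_poissonWeight_sojournTime_succ hlam n j] at h1
  have h2 : Tendsto (fun n => ∑ i ∈ Finset.range (j + 1),
        (∫ ω, poissonWeight (i + 1) (lam * sojournTime (fun k => X k ω) (fun k => S k ω) n) ∂P +
          if i = 0 then
            ∫ ω, poissonWeight 0 (lam * sojournTime (fun k => X k ω) (fun k => S k ω) n) ∂P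
          else 0) * ∫ ω, poissonWeight (j - i) (lam * S 0 ω) ∂P) atTop
      (𝓝 (∑ i ∈ Finset.range (j + 1), (limitDist P lam X S (i + 1) +
        if i = 0 then limitDist P lam X S 0 else 0) *
          ∫ ω, poissonWeight (j - i) (lam * S 0 ω) ∂P)) := by
    refine tendsto_finsetSum _ fun i _ => ((hlim (i + 1)).add ?_).mul_const _
    split_ifs
    · exact hlim 0
    · exact tendsto_const_nhds
  rw [tendsto_nhds_unique h1 h2]
  simp only [add_mul, Finset.sum_add_distrib, ite_mul, zero_mul]
  rw [Finset.sum_ite_eq' (Finset.range (j + 1)) 0, if_pos (Finset.mem_range.2 j.succ_pos),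
    Nat.sub_zero, add_comm]

/-- The Laplace transform of the stationary waiting time. -/
lemma laplace_stationaryLindley {θ : ℝ} (hθ : 0 ≤ θ) :
    (lam - θ) * ∫ y, Real.exp (-(θ * stationaryLindley y)) ∂(driveLaw P X S) =
      lam * ((∫ y, Real.exp (-(θ * stationaryLindley y)) ∂(driveLaw P X S)) *
        ∫ ω, Real.exp (-(θ * S 0 ω)) ∂P) -
      θ * ((∫ y, Real.exp (-(lam * stationaryLindley y)) ∂(driveLaw P X S)) *
        ∫ ω, Real.exp (-(lam * S 0 ω)) ∂P) := by
  have := h.isProbabilityMeasure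
  have hcont : ∀ θ : ℝ, Continuous fun v : ℝ => Real.exp (-(θ * v)) := fun θ => by fun_prop
  have hbd : ∀ {θ : ℝ}, 0 ≤ θ → ∀ v, 0 ≤ v → ‖Real.exp (-(θ * v))‖ ≤ 1 :=
    fun hθ v hv => exp_neg_mul_norm_le_one hθ hv
  have hlim := fun {θ : ℝ} (hθ : 0 ≤ θ) =>
    h.tendsto_integral_waitingTime hlam hlt (hcont θ) (hbd hθ)
  have hmul : ∀ (θ : ℝ) n,
      ∫ ω, Real.exp (-(θ * sojournTime (fun k => X k ω) (fun k => S k ω) n)) ∂P =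
      (∫ ω, Real.exp (-(θ * waitingTime (fun k => X k ω) (fun k => S k ω) n)) ∂P) *
        ∫ ω, Real.exp (-(θ * S 0 ω)) ∂P := by
    intro θ n
    have h1 := ((h.identDistrib_service n).comp (hcont θ).measurable).integral_eq
    have h2 := (h.indepFun_waitingTime_service n).integral_fun_comp_mul_comp
      (h.measurable_waitingTime n).aemeasurable (h.measurable_service n).aemeasurable
      (f := fun v => Real.exp (-(θ * v))) (g := fun v => Real.exp (-(θ * v)))
      (hcont θ).measurable.aestronglyMeasurable (hcont θ).measurable.aestronglyMeasurable
    simp only [Function.comp_apply] at h1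
    rw [← h1, ← h2]
    simp only [sojournTime, mul_add, neg_add, Real.exp_add]
  have hrec : ∀ n, (lam - θ) * ∫ ω, Real.exp (-(θ * waitingTime (fun k => X k ω) (fun k => S k ω)
      (n + 1))) ∂P =
      lam * ((∫ ω, Real.exp (-(θ * waitingTime (fun k => X k ω) (fun k => S k ω) n)) ∂P) *
        ∫ ω, Real.exp (-(θ * S 0 ω)) ∂P) -
      θ * ((∫ ω, Real.exp (-(lam * waitingTime (fun k => X k ω) (fun k => S k ω) n)) ∂P) *
        ∫ ω, Real.exp (-(lam * S 0 ω)) ∂P) := by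
    intro n
    rw [h.integral_waitingTime_succ n (hcont θ) (hbd hθ), ← hmul, ← hmul,
      ← integral_const_mul, ← integral_const_mul, ← integral_const_mul, ← integral_sub]
    · refine integral_congr_ae ?_
      filter_upwards [h.ae_sojournTime_nonneg n] with ω hω
      exact integral_exp_max hlam hω θ
    · exact (integrable_exp_neg_mul (h.measurable_sojournTime n) (h.ae_sojournTime_nonneg n)
        hθ).const_mul _
    · exact (integrable_exp_neg_mul (h.measurable_sojournTime n) (h.ae_sojournTime_nonneg n)
        hlam.le).const_mul _
  have h1 := ((tendsto_add_atTop_iff_nat 1).2 (hlim hθ)).const_mul (lam - θ)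
  simp_rw [hrec] at h1
  exact tendsto_nhds_unique h1 ((((hlim hθ).mul_const _).const_mul lam).sub
    (((hlim hlam.le).mul_const _).const_mul θ))

/-- The mean of the stationary waiting time, from the expansion of its Laplace transform at `0`. -/
lemma integrable_and_integral_stationaryLindley :
    Integrable stationaryLindley (driveLaw P X S) ∧
      ∫ y, stationaryLindley y ∂(driveLaw P X S) =
        lam * ((sigma ^ 2 + (1 / mu) ^ 2) / 2) / (1 - lam * (1 / mu)) := by
  have := h.isProbabilityMeasure
  have := h.isProbabilityMeasure_driveLaw
  have hmu : 0 < mu := hlam.trans hlt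
  have hρ : 0 < 1 - lam * (1 / mu) := by
    rw [mul_one_div, sub_pos]; exact (div_lt_one hmu).2 hlt
  have hM0 : ∀ᵐ y ∂(driveLaw P X S), 0 ≤ stationaryLindley y :=
    Eventually.of_forall stationaryLindley_nonneg
  refine integrable_and_integral_eq_of_tendsto measurable_stationaryLindley hM0 ?_
  set φ : ℝ → ℝ := fun θ => ∫ y, Real.exp (-(θ * stationaryLindley y)) ∂(driveLaw P X S)
  set ψ : ℝ → ℝ := fun θ => ∫ ω, Real.exp (-(θ * S 0 ω)) ∂P
  have hφ : Tendsto φ (𝓝[>] 0) (𝓝 1) := tendsto_integral_exp_neg measurable_stationaryLindley hM0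
  have hψ1 : Tendsto (fun θ => (1 - ψ θ) / θ) (𝓝[>] 0) (𝓝 (1 / mu)) := by
    rw [← h.mean_service]
    exact tendsto_one_sub_integral_exp_neg_div (h.measurable_service 0) (h.service_nonneg 0)
      h.integrable_service
  have hψ2 : Tendsto (fun θ => (θ * (1 / mu) - (1 - ψ θ)) / θ ^ 2) (𝓝[>] 0)
      (𝓝 ((sigma ^ 2 + (1 / mu) ^ 2) / 2)) := by
    rw [← h.integral_service_sq, ← h.mean_service]
    exact tendsto_sub_one_add_integral_exp_neg_div (h.measurable_service 0) (h.service_nonneg 0)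
      h.integrable_service h.memLp_service.integrable_sq
  have heq : ∀ᶠ θ in 𝓝[>] (0 : ℝ), φ θ * (1 - lam * ((1 - ψ θ) / θ)) = φ lam * ψ lam := by
    filter_upwards [self_mem_nhdsWithin] with θ hθ
    have hθ : 0 < θ := hθ
    have := h.laplace_stationaryLindley hlam hlt hθ.le
    change (lam - θ) * φ θ = lam * (φ θ * ψ θ) - θ * (φ lam * ψ lam) at this
    field_simp
    linear_combination -this
  have hden : Tendsto (fun θ => 1 - lam * ((1 - ψ θ) / θ)) (𝓝[>] 0) (𝓝 (1 - lam * (1 / mu))) :=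
    (hψ1.const_mul lam).const_sub 1
  -- the probability of an empty system is `1 - ρ`
  have hc : φ lam * ψ lam = 1 - lam * (1 / mu) := by
    have h1 := (hφ.mul hden).congr' heq
    rw [one_mul] at h1
    exact tendsto_nhds_unique tendsto_const_nhds h1
  refine ((hψ2.const_mul lam).div hden hρ.ne').congr' ?_
  filter_upwards [heq, hden.eventually_const_lt hρ, self_mem_nhdsWithin] with θ h1 h2 hθ
  have hθ : 0 < θ := hθ
  rw [hc] at h1
  have h3 : φ θ = (1 - lam * (1 / mu)) / (1 - lam * ((1 - ψ θ) / θ)) := by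
    rw [eq_div_iff h2.ne', h1]
  change lam * ((θ * (1 / mu) - (1 - ψ θ)) / θ ^ 2) / (1 - lam * ((1 - ψ θ) / θ)) = (1 - φ θ) / θ
  rw [h3]
  generalize hd : 1 - lam * ((1 - ψ θ) / θ) = d at h2
  have h2' : d ≠ 0 := h2.ne'
  have h4 : lam * (1 - ψ θ) = θ * (1 - d) := by
    rw [← hd]; field_simp; ring
  have h5 : lam * ((θ * (1 / mu) - (1 - ψ θ)) / θ ^ 2) =
      (d - (1 - lam * (1 / mu))) / θ := by
    rw [mul_div_assoc', mul_sub, h4]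
    field_simp
    ring
  rw [h5]
  field_simp

/-- The mean number left behind is `lam` times the mean stationary sojourn time. -/
lemma hasSum_mul_limitDist : HasSum (fun k : ℕ => (k : ℝ) * limitDist P lam X S k)
    (lam * (1 / mu + ∫ y, stationaryLindley y ∂(driveLaw P X S))) := by
  have := h.isProbabilityMeasure
  have := h.isProbabilityMeasure_driveLaw
  have hV := h.measurable_stationarySojourn
  have h0 := h.ae_stationarySojourn_nonneg
  have hMi := (h.integrable_and_integral_stationaryLindley hlam hlt).1
  have hSi : Integrable (fun p : Ω × (ℤ → ℝ) => S 0 p.1) (P.prod (driveLaw P X S)) :=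
    h.integrable_service.comp_fst _
  have hMi' : Integrable (fun p : Ω × (ℤ → ℝ) => stationaryLindley p.2)
      (P.prod (driveLaw P X S)) := hMi.comp_snd _
  have hmean : ∫ p, lam * stationarySojourn S p ∂(P.prod (driveLaw P X S)) =
      lam * (1 / mu + ∫ y, stationaryLindley y ∂(driveLaw P X S)) := by
    rw [integral_const_mul]
    simp only [stationarySojourn]
    rw [integral_add hSi hMi', integral_fun_fst (fun ω => S 0 ω),
      integral_fun_snd stationaryLindley,
      h.mean_service]
    simp
  have hs : ∀ᵐ p ∂(P.prod (driveLaw P X S)), HasSum (fun k : ℕ =>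
      (k : ℝ) * poissonWeight k (lam * stationarySojourn S p)) (lam * stationarySojourn S p) := by
    filter_upwards [h0] with p hp using hasSum_mul_poissonWeight (by positivity)
  have := hasSum_integral_of_dominated_convergence
    (μ := P.prod (driveLaw P X S))
    (F := fun (k : ℕ) p => (k : ℝ) * poissonWeight k (lam * stationarySojourn S p))
    (f := fun p => lam * stationarySojourn S p)
    (fun k p => (k : ℝ) * poissonWeight k (lam * stationarySojourn S p))
    (fun k => (((continuous_poissonWeight_mul lam k).measurable.comp hV).const_mul
      _).aestronglyMeasurable)
    (fun k => by
      filter_upwards [h0] with p hp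
      rw [Real.norm_of_nonneg (mul_nonneg (Nat.cast_nonneg k)
        (poissonWeight_nonneg k (by positivity)))])
    (hs.mono fun p hp => hp.summable)
    (((hSi.add hMi').const_mul lam).congr (hs.mono fun p hp => hp.tsum_eq.symm)) hs
  rw [hmean] at this
  simp only [integral_const_mul] at this
  exact this

lemma ae_tendsto_average_sojournTime : ∀ᵐ ω ∂P, Tendsto (fun n : ℕ =>
    (∑ i ∈ Finset.range n, sojournTime (fun k => X k ω) (fun k => S k ω) i) / n) atTop
    (𝓝 (1 / mu + ∫ y, stationaryLindley y ∂(driveLaw P X S))) := by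
  have := h.isProbabilityMeasure_difference
  have hW := ae_tendsto_average_lindley (P := P) (U := fun n ω => S n ω - X (n + 1) ω)
    (fun k => (h.measurable_service k).sub (h.measurable_interarrival (k + 1)))
    h.iIndepFun_service_sub_interarrival h.map_service_sub_interarrival
    (h.integrable_difference hlam) (h.integral_difference_neg hlam hlt)
    (h.integrable_and_integral_stationaryLindley hlam hlt).1
  filter_upwards [hW, h.ae_tendsto_average_service] with ω h1 h2
  refine (h2.add h1).congr fun n => ?_
  rw [← add_div, ← Finset.sum_add_distrib]
  congr 1
  refine Finset.sum_congr rfl fun i _ => ?_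
  rw [add_comm]; rfl

end IsMG1

end Mean

end MG1

theorem mainTheorem3 {Ω : Type*} [MeasurableSpace Ω] (P : Measure Ω) [IsProbabilityMeasure P]
    (lam mu sigma rho : ℝ) (hlam : 0 < lam) (hmu : 0 < mu) (hsigma : 0 ≤ sigma)
    (hrho : rho = lam / mu) (hstable : rho < 1)
    (X S : ℕ → Ω → ℝ) (hMG1 : MG1.IsMG1 P lam mu sigma X S) :
    -- the long-run time average of the number in system
    (∀ᵐ ω ∂P, Tendsto (fun T : ℝ => (1 / T) * ∫ t in (0 : ℝ)..T, (MG1.Q X S t ω : ℝ)) atTop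
      (𝓝 (rho + (rho ^ 2 + lam ^ 2 * sigma ^ 2) / (2 * (1 - rho))))) ∧
    -- Kendall's recursion for the numbers left behind at departures
    (∀ᵐ ω ∂P, ∀ i : ℕ, (MG1.q X S (i + 1) ω : ℤ) =
      (MG1.q X S i ω : ℤ) + (MG1.a X S (i + 1) ω : ℤ)
        - (MG1.busyIndicator (MG1.q X S i ω) : ℤ)) ∧
    -- the steady state of the departure chain and its mean
    (∃ p : ℕ → ℝ, MG1.IsDistribution p ∧
      (∀ k : ℕ, Tendsto (fun i : ℕ => P.real {ω | MG1.q X S i ω = k}) atTop (𝓝 (p k))) ∧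
      (∀ i : ℕ, ∀ p' : ℕ → ℝ, MG1.IsDistribution p' →
        (MG1.IsSteadyState P (MG1.a X S i) p' ↔ p' = p)) ∧
      HasSum (fun k : ℕ => (k : ℝ) * p k)
        (rho + (rho ^ 2 + lam ^ 2 * sigma ^ 2) / (2 * (1 - rho)))) := by
  have hlt : lam < mu := by rwa [hrho, div_lt_one hmu] at hstable
  have hmean : lam * (1 / mu + ∫ y, MG1.stationaryLindley y ∂(MG1.driveLaw P X S)) =
      rho + (rho ^ 2 + lam ^ 2 * sigma ^ 2) / (2 * (1 - rho)) := by
    have h1 : 1 - rho ≠ 0 := (sub_pos.2 hstable).ne'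
    rw [(hMG1.integrable_and_integral_stationaryLindley hlam hlt).2, mul_one_div, ← hrho]
    have h2 : lam * (1 / mu) = rho := by rw [hrho, mul_one_div]
    rw [mul_add, h2, add_right_inj, ← h2]
    rw [← h2] at h1
    field_simp
    ring
  refine ⟨?_, ?_, MG1.limitDist P lam X S, hMG1.isDistribution_limitDist hlam,
    hMG1.tendsto_measureReal_q hlam hlt, fun i p' hp' => ?_, ?_⟩
  · filter_upwards [hMG1.ae_regularPath hlam, hMG1.ae_tendsto_arrivalTime_div hlam,
      hMG1.ae_tendsto_average_sojournTime hlam hlt] with ω h1 h2 h3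
    rw [← hmean]
    exact h1.tendsto_average_numberInSystem hlam h2 h3
  · filter_upwards [hMG1.ae_regularPath hlam] with ω hω i
    exact hω.kendall i
  · rw [MG1.isSteadyState_iff (hMG1.measureReal_a_eq hlam i)]
    refine ⟨fun hss => (hMG1.isDistribution_limitDist hlam).eq_of_steadyState ?_ hp'
      (hMG1.limitDist_eq hlam hlt) hss, ?_⟩
    · simp only [MG1.poissonWeight_zero]
      exact integral_exp_pos (MG1.integrable_exp_neg_mul (hMG1.measurable_service 0)
        (hMG1.service_nonneg 0) hlam.le)
    · rintro rfl
      exact hMG1.limitDist_eq hlam hlt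
  · rw [← hmean]
    exact hMG1.hasSum_mul_limitDist hlam hlt
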